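/- **Linear erasure for the asymmetric signal-rule (ASR).** Every site $i\in\mathbb Z$ carries four binary registers $\mathrm{Def}_i,\mathrm{FwS}_i,\mathrm{BwS}_i,\mathrm{AnS}_i\in\{0,1\}$ (defect, forward-signal, backward-signal, anti-signal) and a stack $\mathrm{Sta}_i\in\mathbb N$. For a configuration $u\in(\{0,1\}^4\times\mathbb N)^{\mathbb Z}$ let $\Sigma(u)=\{i:\mathrm{Def}_i=1\}$, and let $\mathrm{supp}(u)$ be the set of sites at which some register is nonzero. One iteration of the ASR, with anti-signals and backward-signals of speed $3$, applies the following steps in order, each step simultaneously at all sites $i$: 1. Let $\mathrm{Cor}_i=1$ if $(\mathrm{Def}_{i-1},\mathrm{Def}_i,\mathrm{Def}_{i+1})=(0,1,1)$ and $\mathrm{Cor}_i=0$ otherwise; then set $\mathrm{Def}_i$ to $0$ if $\mathrm{Cor}_i=1$ or $\mathrm{Cor}_{i-1}=1$. 2. If $\mathrm{Def}_i=1$, $\mathrm{Def}_{i+1}=0$ and $\mathrm{FwS}_i=0$, set $\mathrm{FwS}_i$ to $1$ and increment $\mathrm{Sta}_i$ by $1$. 3. Replace $\mathrm{FwS}_i$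 by $\mathrm{FwS}_{i-1}$. 4. Let $\mathrm{Tmp}_i=1$ if $\mathrm{Def}_i=\mathrm{FwS}_i=1$ and $\mathrm{Tmp}_i=0$ otherwise. Where $\mathrm{Tmp}_i=1$, set $\mathrm{Def}_i$ to $0$ and, if $(\mathrm{FwS}_i,\mathrm{BwS}_i)=(1,0)$, replace this pair by $(0,1)$. Then, where $\mathrm{Tmp}_{i+1}=1$, set $\mathrm{Def}_i$ to $1$ and, if $(\mathrm{FwS}_i,\mathrm{BwS}_i)=(1,0)$, replace this pair by $(0,1)$. 5. Three times: replace $\mathrm{BwS}_i$ by $\mathrm{BwS}_{i+1}$; then, if $\mathrm{BwS}_i=\mathrm{AnS}_i=1$, set both to $0$; then, if $\mathrm{BwS}_i=1$ and $\mathrm{Sta}_i>0$, set $\mathrm{BwS}_i$ to $0$ and decrement $\mathrm{Sta}_i$ by $1$. 6. If $\mathrm{Def}_i=\mathrm{AnS}_i=0$ and $\mathrm{Sta}_i>0$, set $\mathrm{AnS}_i$ to $1$ and decrement $\mathrm{Sta}_i$ by $1$. 7. Twice: replace $\mathrm{AnS}_i$ by $\mathrm{AnS}_{i-1}$; then, if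 $\mathrm{AnS}_i=\mathrm{FwS}_i=1$, set both to $0$; then, if $\mathrm{AnS}_i=\mathrm{BwS}_i=1$, set both to $0$. 8. Replace $\mathrm{AnS}_i$ by $\mathrm{AnS}_{i-1}$; then, if $\mathrm{AnS}_i=\mathrm{BwS}_i=1$, set both to $0$. **Theorem.** Let $m\ge 1$, let $\sigma_1<\dots<\sigma_{2m}$ be integers, and put $\Delta:=\sigma_{2m}-\sigma_1$. Let $u^{(0)}$ be the configuration with $\Sigma(u^{(0)})=\{\sigma_1,\dots,\sigma_{2m}\}$ and all other registers zero, and let $u^{(t)}$ be obtained from $u^{(0)}$ by $t$ iterations of the ASR. Then for all $t\ge 0$, $$\Sigma(u^{(t)})\subset[\sigma_1,\sigma_1+\Delta],\qquad \mathrm{supp}(u^{(t)})\subset[\sigma_1,\sigma_1+78\Delta],$$ and for all $t>77\Delta$, $$\mathrm{supp}(u^{(t)})=\varnothing .$$ -/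

import Mathlib

namespace ASR

/-- The registers of one site: the presence of a defect, of a forward-signal, of a
backward-signal and of an anti-signal, and the value of the stack. -/
@[ext]
structure Site where
  dfc : Bool
  fwS : Bool
  bwS : Bool
  anS : Bool
  sta : ℕ

/-- The site all of whose registers are zero. -/
def Site.zero : Site := ⟨false, false, false, false, 0⟩

/-- A configuration of the decoder on the infinite lattice `ℤ`. -/
abbrev Config := ℤ → Site

/-- The set of defects of a configuration. -/
def defects (u : Config) : Set ℤ := {i | (u i).dfc = true}

/-- The set of sites where some register is nonzero. -/
def supp (u : Config) : Set ℤ := {i | u i ≠ Site.zero}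

/-! The phases of one iteration. Each acts in parallel on all the sites; the left and the right
neighbour of site `i` are `i - 1` and `i + 1`. -/

/-- Matching of neighbouring defects. `cor` is the correction register, set where the defect
pattern (left, centre, right) is `(0, 1, 1)`; a defect is removed at the sites with `cor = 1` and
at their right neighbours. -/
def matchDefects (u : Config) : Config :=
  let cor : ℤ → Bool := fun i => !(u (i - 1)).dfc && (u i).dfc && (u (i + 1)).dfc
  fun i => if cor i || cor (i - 1) then { u i with dfc := false } else u i

/-- A defect with no defect on its right, on a site without forward-signal, emits a forward-signal
and increments its stack. -/
def sendForward (u : Config) : Config := fun i =>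
  if (u i).dfc && !(u (i + 1)).dfc && !(u i).fwS then
    { u i with fwS := true, sta := (u i).sta + 1 }
  else u i

/-- Every forward-signal moves one site to the right. -/
def moveForward (u : Config) : Config := fun i => { u i with fwS := (u (i - 1)).fwS }

/-- A forward-signal turns into a backward-signal, provided that the site has no backward-signal
yet. -/
def Site.reflect (s : Site) : Site :=
  if s.fwS && !s.bwS then { s with fwS := false, bwS := true } else s

/-- Correction and signal reflection. `tmp` marks the sites that hold both a defect and a
forward-signal. First each of these loses its defect and reflects its signal; then the site on the
left of each of them receives a defect and reflects its signal, if any. -/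
def correctReflect (u : Config) : Config :=
  let tmp : ℤ → Bool := fun i => (u i).dfc && (u i).fwS
  let v : Config := fun i => if tmp i then { (u i).reflect with dfc := false } else u i
  fun i => if tmp (i + 1) then { (v i).reflect with dfc := true } else v i

/-- Recombination of a backward-signal with an anti-signal. -/
def Site.recombineBwAn (s : Site) : Site :=
  if s.bwS && s.anS then { s with bwS := false, anS := false } else s

/-- Recombination of a backward-signal with a stack increment. -/
def Site.recombineBwSta (s : Site) : Site :=
  if s.bwS && decide (0 < s.sta) then { s with bwS := false, sta := s.sta - 1 } else s

/-- Recombination of a forward-signal with an anti-signal. -/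
def Site.recombineFwAn (s : Site) : Site :=
  if s.fwS && s.anS then { s with fwS := false, anS := false } else s

/-- Every backward-signal moves one site to the left. -/
def moveBackward (u : Config) : Config := fun i => { u i with bwS := (u (i + 1)).bwS }

/-- Every anti-signal moves one site to the right. -/
def moveAnti (u : Config) : Config := fun i => { u i with anS := (u (i - 1)).anS }

/-- One elementary step of the backward-signals: they move by one, then recombine with
anti-signals, then with stacks. -/
def backwardStep (u : Config) : Config := fun i =>
  (moveBackward u i).recombineBwAn.recombineBwSta

/-- A nonempty stack on a site without defect and without anti-signal emits an anti-signal. -/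
def sendAnti (u : Config) : Config := fun i =>
  if !(u i).dfc && !(u i).anS && decide (0 < (u i).sta) then
    { u i with anS := true, sta := (u i).sta - 1 }
  else u i

/-- One elementary step of the anti-signals: they move by one, then recombine with
forward-signals, then with backward-signals. -/
def antiStep (u : Config) : Config := fun i =>
  (moveAnti u i).recombineFwAn.recombineBwAn

/-- The last elementary step of the anti-signals in an iteration: they move by one and recombine
with backward-signals only. -/
def antiLastStep (u : Config) : Config := fun i =>
  (moveAnti u i).recombineBwAn

/-- One iteration of the asymmetric signal-rule, for anti-signals of speed `ka ≥ 1` and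
backward-signals of speed `kb`. -/
def iteration (ka kb : ℕ) (u : Config) : Config :=
  let u₁ := correctReflect (moveForward (sendForward (matchDefects u)))
  let u₂ := sendAnti (backwardStep^[kb] u₁)
  antiLastStep (antiStep^[ka - 1] u₂)

/-- The configuration with set of defects `S` and all the other registers zero. -/
def initial (S : Finset ℤ) : Config := fun i => { Site.zero with dfc := decide (i ∈ S) }

/-- The configuration at time `t` of the asymmetric signal-rule, with both speeds equal to `3`,
started from the set of defects `S` with all the other registers zero. -/
def evolution (S : Finset ℤ) (t : ℕ) : Config := (iteration 3 3)^[t] (initial S)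

end ASR

/-
The charge of a site, stack plus anti-signal minus forward- and backward-signals, is preserved by
all the emissions and recombinations, so its sum over the sites `≤ i` changes only when a signal
crosses the bond `(i, i + 1)`. This height stays nonnegative and vanishes on the left of each defect
and far on the right, which keeps the defects and signals from leaving the initial interval
`[a, b]` on the left, and gives the speed limit `1` of the support on the right.

Number the defects from the left. Behind a front, initially at `a`, the gaps after the defects of
odd rank are filled with forward-signals and free of debts, and the other gaps hold no
forward-signal. The front only waits for the debts ahead of it and for the next defect, which moves
to the left once per block of forward-signals reaching it; a potential accounting for both
decreases in each iteration, and the front has passed `b` by time `5 (b - a)`. From then on each gap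
after a defect of odd rank is shortened in each iteration, and no defect is left at time
`6 (b - a)`. Since the height bounds the total of the stacks, a sweep from the left then empties
them in linear time, the anti-signals overtake the forward-signals, and a configuration without
debts and defects has no signals, as its height vanishes.
-/

namespace ASR

/-- The debt of a site: the number of backward-signals that it can absorb, held in its stack and
its anti-signal. -/
def debt (s : Site) : ℕ := s.sta + s.anS.toNat

/-- The charge of a site: debts count positively, forward- and backward-signals negatively. Every
emission and every recombination preserves it. -/
def charge (s : Site) : ℤ := debt s - (s.fwS.toNat + s.bwS.toNat)

/-- The register `Cor`: the defects at `i` and `i + 1` are matched at the beginning of the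
iteration. -/
def cor (u : Config) (i : ℤ) : Bool := !(u (i - 1)).dfc && (u i).dfc && (u (i + 1)).dfc

/-- The register `Tmp` of an iteration without matching: the defect at `i` is reached by a
forward-signal and moves to `i - 1`. -/
def hits (u : Config) (i : ℤ) : Bool := (u i).dfc && (u (i - 1)).fwS

/-- The configuration after the correction and the reflection of the signals, in an iteration
without matching. -/
def reflected (u : Config) : Config := correctReflect (moveForward (sendForward u))

/-- The configuration that `k` elementary steps of the backward-signals make of `reflected u`. -/
def backward (u : Config) (k : ℕ) : Config := backwardStep^[k] (reflected u)

/-- The configuration after the emission of the anti-signals, in an iteration without matching. -/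
def emitted (u : Config) : Config := sendAnti (backward u 3)

/-- The configuration that `k` elementary steps of the anti-signals make of `emitted u`. -/
def anti (u : Config) (k : ℕ) : Config := antiStep^[k] (emitted u)

/-- An iteration without the matching of neighbouring defects. -/
def propagate (u : Config) : Config := antiLastStep (anti u 2)

lemma iteration_eq (u : Config) : iteration 3 3 u = propagate (matchDefects u) := rfl

lemma debt_eq_zero {s : Site} : debt s = 0 ↔ s.sta = 0 ∧ s.anS = false := by
  simp [debt]

section Registers
variable (u : Config) (i : ℤ) (k : ℕ)

lemma matchDefects_dfc :
    (matchDefects u i).dfc = ((u i).dfc && !cor u i && !cor u (i - 1)) := by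
  simp only [matchDefects, cor]; grind
@[simp] lemma matchDefects_fwS : (matchDefects u i).fwS = (u i).fwS := by
  simp only [matchDefects]; split_ifs <;> rfl
@[simp] lemma matchDefects_bwS : (matchDefects u i).bwS = (u i).bwS := by
  simp only [matchDefects]; split_ifs <;> rfl
@[simp] lemma matchDefects_anS : (matchDefects u i).anS = (u i).anS := by
  simp only [matchDefects]; split_ifs <;> rfl
@[simp] lemma matchDefects_sta : (matchDefects u i).sta = (u i).sta := by
  simp only [matchDefects]; split_ifs <;> rfl
@[simp] lemma debt_matchDefects : debt (matchDefects u i) = debt (u i) := by simp [debt]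
@[simp] lemma charge_matchDefects : charge (matchDefects u i) = charge (u i) := by simp [charge]

@[simp] lemma sendForward_dfc : (sendForward u i).dfc = (u i).dfc := by
  simp only [sendForward]; split_ifs <;> rfl
@[simp] lemma sendForward_bwS : (sendForward u i).bwS = (u i).bwS := by
  simp only [sendForward]; split_ifs <;> rfl
@[simp] lemma sendForward_anS : (sendForward u i).anS = (u i).anS := by
  simp only [sendForward]; split_ifs <;> rfl
lemma sendForward_fwS :
    (sendForward u i).fwS = ((u i).fwS || ((u i).dfc && !(u (i + 1)).dfc)) := by
  simp only [sendForward]; grind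
lemma sendForward_sta : (sendForward u i).sta =
    if (u i).dfc && !(u (i + 1)).dfc && !(u i).fwS then (u i).sta + 1 else (u i).sta := by
  simp only [sendForward]; split_ifs <;> rfl
lemma charge_sendForward : charge (sendForward u i) = charge (u i) := by
  simp only [charge, debt, sendForward_sta, sendForward_fwS, sendForward_bwS, sendForward_anS]
  cases (u i).fwS <;> cases (u i).dfc <;> cases (u (i + 1)).dfc <;> grind

lemma reflected_dfc :
    (reflected u i).dfc = (hits u (i + 1) || ((u i).dfc && !hits u i)) := by
  simp only [reflected, correctReflect, moveForward, hits, Site.reflect, sendForward_dfc,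
    sendForward_fwS, add_sub_cancel_right, sub_add_cancel]
  grind
lemma reflected_fwS : (reflected u i).fwS =
    ((sendForward u (i - 1)).fwS && ((u i).bwS || !(hits u i || hits u (i + 1)))) := by
  simp only [reflected, correctReflect, moveForward, hits, Site.reflect, sendForward_dfc,
    sendForward_bwS, sendForward_fwS, add_sub_cancel_right, sub_add_cancel]
  grind
lemma reflected_bwS : (reflected u i).bwS =
    ((u i).bwS || ((sendForward u (i - 1)).fwS && (hits u i || hits u (i + 1)))) := by
  simp only [reflected, correctReflect, moveForward, hits, Site.reflect, sendForward_dfc,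
    sendForward_bwS, sendForward_fwS, add_sub_cancel_right, sub_add_cancel]
  grind
@[simp] lemma reflected_anS : (reflected u i).anS = (u i).anS := by
  have h := sendForward_anS u i
  simp only [reflected, correctReflect, moveForward, Site.reflect]
  grind
@[simp] lemma reflected_sta : (reflected u i).sta = (sendForward u i).sta := by
  simp only [reflected, correctReflect, moveForward, Site.reflect]
  grind
lemma charge_reflected : charge (reflected u i) =
    charge (u i) + (sendForward u i).fwS.toNat - (sendForward u (i - 1)).fwS.toNat := by
  have h := charge_sendForward u i
  simp only [charge, debt, reflected_sta, reflected_anS, reflected_fwS, reflected_bwS,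
    sendForward_bwS, sendForward_anS] at h ⊢
  cases (sendForward u (i - 1)).fwS <;> cases (u i).bwS <;> cases hits u i <;>
    cases hits u (i + 1) <;> simp at h ⊢ <;> omega

@[simp] lemma backwardStep_dfc : (backwardStep u i).dfc = (u i).dfc := by
  simp only [backwardStep, moveBackward, Site.recombineBwAn, Site.recombineBwSta]; grind
@[simp] lemma backwardStep_fwS : (backwardStep u i).fwS = (u i).fwS := by
  simp only [backwardStep, moveBackward, Site.recombineBwAn, Site.recombineBwSta]; grind
lemma backwardStep_bwS : (backwardStep u i).bwS =
    ((u (i + 1)).bwS && !(u i).anS && decide ((u i).sta = 0)) := by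
  simp only [backwardStep, moveBackward, Site.recombineBwAn, Site.recombineBwSta]; grind
lemma backwardStep_anS : (backwardStep u i).anS = ((u i).anS && !(u (i + 1)).bwS) := by
  simp only [backwardStep, moveBackward, Site.recombineBwAn, Site.recombineBwSta]; grind
lemma backwardStep_sta : (backwardStep u i).sta =
    if (u (i + 1)).bwS && !(u i).anS then (u i).sta - 1 else (u i).sta := by
  simp only [backwardStep, moveBackward, Site.recombineBwAn, Site.recombineBwSta]; grind
lemma debt_backwardStep_le : debt (backwardStep u i) ≤ debt (u i) := by
  rw [debt, backwardStep_sta, backwardStep_anS, debt]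
  cases (u i).anS <;> cases (u (i + 1)).bwS <;> simp
lemma charge_backwardStep : charge (backwardStep u i) =
    charge (u i) + (u i).bwS.toNat - (u (i + 1)).bwS.toNat := by
  simp only [charge, debt, backwardStep_sta, backwardStep_anS, backwardStep_fwS,
    backwardStep_bwS]
  rcases (u i).sta with _ | n <;> cases (u i).anS <;> cases (u (i + 1)).bwS <;>
    simp <;> ring

@[simp] lemma sendAnti_dfc : (sendAnti u i).dfc = (u i).dfc := by simp only [sendAnti]; grind
@[simp] lemma sendAnti_fwS : (sendAnti u i).fwS = (u i).fwS := by simp only [sendAnti]; grind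
@[simp] lemma sendAnti_bwS : (sendAnti u i).bwS = (u i).bwS := by simp only [sendAnti]; grind
lemma sendAnti_anS : (sendAnti u i).anS =
    ((u i).anS || (!(u i).dfc && decide (0 < (u i).sta))) := by simp only [sendAnti]; grind
lemma sendAnti_sta : (sendAnti u i).sta =
    if !(u i).dfc && !(u i).anS then (u i).sta - 1 else (u i).sta := by
  simp only [sendAnti]; grind
@[simp] lemma debt_sendAnti : debt (sendAnti u i) = debt (u i) := by
  rw [debt, sendAnti_sta, sendAnti_anS, debt]
  rcases (u i).sta with _ | n <;> cases (u i).anS <;> cases (u i).dfc <;> simp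
@[simp] lemma charge_sendAnti : charge (sendAnti u i) = charge (u i) := by simp [charge]

@[simp] lemma antiStep_dfc : (antiStep u i).dfc = (u i).dfc := by
  simp only [antiStep, moveAnti, Site.recombineBwAn, Site.recombineFwAn]; grind
@[simp] lemma antiStep_sta : (antiStep u i).sta = (u i).sta := by
  simp only [antiStep, moveAnti, Site.recombineBwAn, Site.recombineFwAn]; grind
lemma antiStep_fwS : (antiStep u i).fwS = ((u i).fwS && !(u (i - 1)).anS) := by
  simp only [antiStep, moveAnti, Site.recombineBwAn, Site.recombineFwAn]; grind
lemma antiStep_bwS : (antiStep u i).bwS =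
    ((u i).bwS && !((u (i - 1)).anS && !(u i).fwS)) := by
  simp only [antiStep, moveAnti, Site.recombineBwAn, Site.recombineFwAn]; grind
lemma antiStep_anS : (antiStep u i).anS =
    ((u (i - 1)).anS && !(u i).fwS && !(u i).bwS) := by
  simp only [antiStep, moveAnti, Site.recombineBwAn, Site.recombineFwAn]; grind
lemma charge_antiStep : charge (antiStep u i) =
    charge (u i) - (u i).anS.toNat + (u (i - 1)).anS.toNat := by
  simp only [charge, debt, antiStep_sta, antiStep_anS, antiStep_fwS, antiStep_bwS]
  cases (u i).fwS <;> cases (u (i - 1)).anS <;> cases (u i).bwS <;> simp <;> ring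

@[simp] lemma antiLastStep_dfc : (antiLastStep u i).dfc = (u i).dfc := by
  simp only [antiLastStep, moveAnti, Site.recombineBwAn]; grind
@[simp] lemma antiLastStep_sta : (antiLastStep u i).sta = (u i).sta := by
  simp only [antiLastStep, moveAnti, Site.recombineBwAn]; grind
@[simp] lemma antiLastStep_fwS : (antiLastStep u i).fwS = (u i).fwS := by
  simp only [antiLastStep, moveAnti, Site.recombineBwAn]; grind
lemma antiLastStep_bwS : (antiLastStep u i).bwS = ((u i).bwS && !(u (i - 1)).anS) := by
  simp only [antiLastStep, moveAnti, Site.recombineBwAn]; grind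
lemma antiLastStep_anS : (antiLastStep u i).anS = ((u (i - 1)).anS && !(u i).bwS) := by
  simp only [antiLastStep, moveAnti, Site.recombineBwAn]; grind
lemma charge_antiLastStep : charge (antiLastStep u i) =
    charge (u i) - (u i).anS.toNat + (u (i - 1)).anS.toNat := by
  simp only [charge, debt, antiLastStep_sta, antiLastStep_anS, antiLastStep_fwS,
    antiLastStep_bwS]
  cases (u (i - 1)).anS <;> cases (u i).bwS <;> simp <;> ring

lemma backward_succ : backward u (k + 1) = backwardStep (backward u k) :=
  Function.iterate_succ_apply' ..
@[simp] lemma backward_dfc : (backward u k i).dfc = (reflected u i).dfc := by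
  induction k with
  | zero => rfl
  | succ k ih => rw [backward_succ, backwardStep_dfc, ih]
@[simp] lemma backward_fwS : (backward u k i).fwS = (reflected u i).fwS := by
  induction k with
  | zero => rfl
  | succ k ih => rw [backward_succ, backwardStep_fwS, ih]
lemma antitone_debt_backward : Antitone fun k => debt (backward u k i) :=
  antitone_nat_of_succ_le fun k => by rw [backward_succ]; exact debt_backwardStep_le _ _
lemma antitone_backward_sta : Antitone fun k => (backward u k i).sta :=
  antitone_nat_of_succ_le fun k => by rw [backward_succ, backwardStep_sta]; split_ifs <;> omega
lemma antitone_backward_anS : Antitone fun k => (backward u k i).anS :=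
  antitone_nat_of_succ_le fun k => by
    rw [backward_succ, backwardStep_anS]; exact Bool.and_le_left _ _

@[simp] lemma emitted_dfc : (emitted u i).dfc = (reflected u i).dfc := by simp [emitted]
@[simp] lemma emitted_fwS : (emitted u i).fwS = (reflected u i).fwS := by simp [emitted]
@[simp] lemma debt_emitted : debt (emitted u i) = debt (backward u 3 i) := by simp [emitted]
lemma debt_backward_le_sendForward : debt (backward u k i) ≤ debt (sendForward u i) :=
  (antitone_debt_backward u i k.zero_le).trans_eq (by simp [debt, backward])

lemma anti_succ : anti u (k + 1) = antiStep (anti u k) := Function.iterate_succ_apply' ..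
@[simp] lemma anti_dfc : (anti u k i).dfc = (reflected u i).dfc := by
  induction k with
  | zero => exact emitted_dfc u i
  | succ k ih => rw [anti_succ, antiStep_dfc, ih]
@[simp] lemma anti_sta : (anti u k i).sta = (emitted u i).sta := by
  induction k with
  | zero => rfl
  | succ k ih => rw [anti_succ, antiStep_sta, ih]

@[simp] lemma propagate_dfc : (propagate u i).dfc = (reflected u i).dfc := by simp [propagate]
@[simp] lemma propagate_sta : (propagate u i).sta = (emitted u i).sta := by simp [propagate]
lemma propagate_fwS : (propagate u i).fwS =
    ((reflected u i).fwS && !(anti u 0 (i - 1)).anS && !(anti u 1 (i - 1)).anS) := by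
  rw [propagate, antiLastStep_fwS, anti_succ, antiStep_fwS, anti_succ, antiStep_fwS, anti,
    Function.iterate_zero, id_eq, emitted_fwS]

end Registers

/-- `h` is a height of `u`: it increases at each site by the charge of the site. -/
def IsHeight (h : ℤ → ℤ) (u : Config) : Prop := ∀ i, h i = h (i - 1) + charge (u i)

/-- The heights of the configurations `backward u k`, for a height `h` of `u`: a height grows
when a forward-signal crosses the bond to the right, and falls when a backward-signal crosses it
to the left. -/
def backwardHeight (h : ℤ → ℤ) (u : Config) : ℕ → ℤ → ℤ
  | 0, i => h i + (sendForward u i).fwS.toNat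
  | k + 1, i => backwardHeight h u k i - (backward u k (i + 1)).bwS.toNat

/-- The heights of the configurations `anti u k`, for a height `h` of `u`: an anti-signal crossing
a bond lowers the height there. The value at `3` is the height of `propagate u`. -/
def antiHeight (h : ℤ → ℤ) (u : Config) : ℕ → ℤ → ℤ
  | 0, i => backwardHeight h u 3 i
  | k + 1, i => antiHeight h u k i - (anti u k i).anS.toNat

/-- The local invariants of the configurations between two iterations: they have a nonnegative
height `h`, vanishing on the left of each defect. -/
structure Balanced (u : Config) (h : ℤ → ℤ) : Prop where
  height : IsHeight h u
  nonneg : ∀ i, 0 ≤ h i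
  debt_of_bwS : ∀ i, (u i).bwS = true → debt (u i) = 0
  height_of_dfc : ∀ i, (u i).dfc = true → h (i - 1) = 0
  fwS_of_dfc : ∀ i, (u i).dfc = true → (u i).fwS = false
  bwS_of_dfc : ∀ i, (u i).dfc = true → (u (i - 1)).bwS = false
  anS_of_dfc : ∀ i, (u i).dfc = true → (u i).anS = false

/-- The registers and the height of `u` vanish on the left of `a`; there are no defects,
stacks and backward-signals on the right of `b`, and no forward-signals on the right of `r`, where
the height vanishes. -/
structure Confined (a b r : ℤ) (u : Config) (h : ℤ → ℤ) : Prop where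
  left : ∀ i < a, u i = Site.zero
  height_left : ∀ i < a, h i = 0
  height_right : ∀ i, r ≤ i → h i = 0
  dfc_le : ∀ i, (u i).dfc = true → i ≤ b
  sta_le : ∀ i, 0 < (u i).sta → i ≤ b
  bwS_le : ∀ i, (u i).bwS = true → i ≤ b
  fwS_le : ∀ i, (u i).fwS = true → i ≤ r
  le : b ≤ r

section Heights
variable {h : ℤ → ℤ} {u : Config} {i : ℤ} {k : ℕ}

lemma IsHeight.one_le_of_bwS (H : IsHeight h u) (h0 : ∀ i, 0 ≤ h i)
    (hb : (u (i + 1)).bwS = true) (hs : debt (u (i + 1)) = 0) : 1 ≤ h i := by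
  have hi := H (i + 1)
  have := h0 (i + 1)
  simp only [add_sub_cancel_right, charge, hb, hs, Bool.toNat_true] at hi
  omega

lemma IsHeight.one_le_of_anS (H : IsHeight h u) (h0 : ∀ i, 0 ≤ h i) (ha : (u i).anS = true)
    (hf : (u i).fwS = false) (hb : (u i).bwS = false) : 1 ≤ h i := by
  have hi := H i
  have := h0 (i - 1)
  simp only [charge, debt, ha, hf, hb, Bool.toNat_true, Bool.toNat_false] at hi
  omega

protected lemma IsHeight.backward (H : IsHeight h u) (k : ℕ) :
    IsHeight (backwardHeight h u k) (backward u k) := by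
  induction k with
  | zero =>
    intro i
    simp only [backward, Function.iterate_zero, id_eq, backwardHeight, charge_reflected, H i]
    ring
  | succ k ih =>
    intro i
    simp only [backward_succ, backwardHeight, charge_backwardStep, ih i, sub_add_cancel]
    ring

protected lemma IsHeight.anti (H : IsHeight h u) (k : ℕ) :
    IsHeight (antiHeight h u k) (anti u k) := by
  induction k with
  | zero =>
    intro i
    rw [anti, Function.iterate_zero, id_eq, emitted, charge_sendAnti]
    exact H.backward 3 i
  | succ k ih =>
    intro i
    simp only [anti_succ, antiHeight, charge_antiStep, ih i]
    ring

protected lemma IsHeight.propagate (H : IsHeight h u) :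
    IsHeight (antiHeight h u 3) (propagate u) := by
  intro i
  have h3 (j) : antiHeight h u 3 j = antiHeight h u 2 j - (anti u 2 j).anS.toNat := rfl
  rw [propagate, charge_antiLastStep, h3, h3, H.anti 2 i]
  ring

lemma debt_backwardStep_of_bwS (hb : (backwardStep u i).bwS = true) :
    debt (backwardStep u i) = 0 := by
  rw [backwardStep_bwS] at hb
  rw [debt_eq_zero, backwardStep_sta, backwardStep_anS]
  grind

lemma antiStep_signals_of_anS (ha : (antiStep u i).anS = true) :
    (antiStep u i).fwS = false ∧ (antiStep u i).bwS = false := by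
  rw [antiStep_anS] at ha
  rw [antiStep_fwS, antiStep_bwS]
  grind

lemma antitone_backwardHeight : Antitone fun k => backwardHeight h u k i :=
  antitone_nat_of_succ_le fun k => by rw [backwardHeight]; omega

lemma antitone_antiHeight : Antitone fun k => antiHeight h u k i :=
  antitone_nat_of_succ_le fun k => by rw [antiHeight]; omega

lemma antiHeight_le (l : ℕ) (hl : l ≤ 3) : antiHeight h u k i ≤ backwardHeight h u l i :=
  (antitone_antiHeight k.zero_le).trans (antitone_backwardHeight hl)

end Heights

namespace Balanced
variable {h : ℤ → ℤ} {u : Config} {i : ℤ} {k : ℕ}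

lemma one_le_of_bwS (B : Balanced u h) (hb : (u (i + 1)).bwS = true) : 1 ≤ h i :=
  B.height.one_le_of_bwS B.nonneg hb (B.debt_of_bwS _ hb)

lemma one_le_of_reflected_bwS (B : Balanced u h) (hb : (reflected u (i + 1)).bwS = true) :
    1 ≤ backwardHeight h u 0 i := by
  have := B.nonneg i
  rw [backwardHeight]
  by_cases hu : (u (i + 1)).bwS = true
  · have := B.one_le_of_bwS hu
    omega
  · rw [reflected_bwS, add_sub_cancel_right] at hb
    have hf : (sendForward u i).fwS = true := by grind
    rw [hf, Bool.toNat_true]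
    omega

lemma nonneg_backwardHeight (B : Balanced u h) (k : ℕ) : ∀ i, 0 ≤ backwardHeight h u k i := by
  induction k with
  | zero => exact fun i => add_nonneg (B.nonneg i) (Int.natCast_nonneg _)
  | succ k ih =>
    intro i
    have h0 := ih i
    rw [backwardHeight]
    cases hb : (backward u k (i + 1)).bwS with
    | false => simpa using h0
    | true =>
      suffices 1 ≤ backwardHeight h u k i by simpa using this
      cases k with
      | zero => exact B.one_le_of_reflected_bwS hb
      | succ k =>
        refine (B.height.backward (k + 1)).one_le_of_bwS ih hb ?_
        rw [backward_succ] at hb ⊢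
        exact debt_backwardStep_of_bwS hb

lemma one_le_backwardHeight_of_bwS (B : Balanced u h) (hb : (backward u k (i + 1)).bwS = true) :
    1 ≤ backwardHeight h u k i := by
  have := B.nonneg_backwardHeight (k + 1) i
  rw [backwardHeight, hb, Bool.toNat_true] at this
  omega

/- As long as the debt at `i + 1` is not exhausted, no backward-signal crosses the bond
`(i, i + 1)` to the left, except one which was there before the forward-signal arrived. -/
lemma one_le_backwardHeight_of_debt (B : Balanced u h) (hf : (reflected u (i + 1)).fwS = true)
    (k : ℕ) (hd : debt (backward u k (i + 1)) ≠ 0) : 1 ≤ backwardHeight h u k i := by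
  rw [reflected_fwS, add_sub_cancel_right, Bool.and_eq_true] at hf
  have h0 := B.nonneg i
  have one_add : backwardHeight h u 0 i = h i + 1 := by simp [backwardHeight, hf.1]
  induction k with
  | zero => omega
  | succ k ih =>
    have hb : backwardHeight h u (k + 1) i =
        backwardHeight h u k i - (backward u k (i + 1)).bwS.toNat := rfl
    cases k with
    | zero =>
      have hr : (backward u 0 (i + 1)).bwS = (u (i + 1)).bwS := by
        have := reflected_bwS u (i + 1)
        rw [add_sub_cancel_right] at this
        change (reflected u (i + 1)).bwS = _
        grind
      rw [hb, hr, one_add]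
      by_cases hu : (u (i + 1)).bwS = true
      · have := B.one_le_of_bwS hu
        have := (u (i + 1)).bwS.toNat_le
        omega
      · simp [hu, h0]
    | succ k =>
      have hd' : debt (backward u (k + 1) (i + 1)) ≠ 0 := fun hz =>
        hd (Nat.le_zero.1 (hz ▸ antitone_debt_backward u (i + 1) (k + 1).le_succ))
      have hb' : (backward u (k + 1) (i + 1)).bwS = false :=
        Bool.eq_false_iff.2 fun hb' => hd' <| by
          rw [backward_succ] at hb' ⊢; exact debt_backwardStep_of_bwS hb'
      simpa [hb, hb'] using ih hd'

lemma bwS_of_emitted_anS (ha : (emitted u i).anS = true) : (emitted u i).bwS = false := by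
  refine Bool.eq_false_iff.2 fun hb => ?_
  rw [emitted, sendAnti_bwS, backward_succ] at hb
  have hs : debt (emitted u i) = 0 := by
    rw [debt_emitted, backward_succ, debt_backwardStep_of_bwS hb]
  exact absurd ha (by simp [(debt_eq_zero.1 hs).2])

lemma one_le_of_emitted_anS (B : Balanced u h) (ha : (emitted u i).anS = true) :
    1 ≤ backwardHeight h u 3 i := by
  have hi := B.height.anti 0 i
  have h0 := B.nonneg_backwardHeight 3 (i - 1)
  have hd : 1 ≤ debt (emitted u i) := by rw [debt, ha]; simp
  simp only [antiHeight, anti, Function.iterate_zero, id_eq, charge, bwS_of_emitted_anS ha,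
    Bool.toNat_false] at hi
  cases hf : (emitted u i).fwS with
  | false =>
    rw [hf, Bool.toNat_false] at hi
    omega
  | true =>
    rw [emitted_fwS] at hf
    rw [debt_emitted] at hd
    have := B.one_le_backwardHeight_of_debt (i := i - 1) (by simpa using hf) 3
      (by rw [sub_add_cancel]; omega)
    have := (emitted u i).fwS.toNat_le
    rw [debt_emitted] at hi
    omega

lemma nonneg_antiHeight (B : Balanced u h) (k : ℕ) : ∀ i, 0 ≤ antiHeight h u k i := by
  induction k with
  | zero => exact B.nonneg_backwardHeight 3
  | succ k ih =>
    intro i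
    have h0 := ih i
    rw [antiHeight]
    cases ha : (anti u k i).anS with
    | false => simpa using h0
    | true =>
      suffices 1 ≤ antiHeight h u k i by simpa using this
      cases k with
      | zero => exact B.one_le_of_emitted_anS ha
      | succ k =>
        obtain ⟨hf, hb⟩ := antiStep_signals_of_anS (anti_succ u k ▸ ha)
        rw [← anti_succ] at hf hb
        exact (B.height.anti (k + 1)).one_le_of_anS ih ha hf hb

lemma backward_bwS_of_height (B : Balanced u h) (h0 : backwardHeight h u k i = 0) :
    (backward u k (i + 1)).bwS = false :=
  Bool.eq_false_iff.2 fun hb => by have := B.one_le_backwardHeight_of_bwS hb; omega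

lemma antiHeight_eq_zero (B : Balanced u h) {l : ℕ} (h0 : backwardHeight h u l i = 0)
    (hl : l ≤ 3) : antiHeight h u k i = 0 :=
  le_antisymm (h0 ▸ antiHeight_le l hl) (B.nonneg_antiHeight k i)

lemma anti_anS_of_height (B : Balanced u h) {l : ℕ} (h0 : backwardHeight h u l i = 0)
    (hl : l ≤ 3) : (anti u k i).anS = false := by
  have hk := B.antiHeight_eq_zero (k := k) h0 hl
  have hk' := B.antiHeight_eq_zero (k := k + 1) h0 hl
  rw [antiHeight, hk] at hk'
  exact Bool.toNat_eq_zero.1 (by omega)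

end Balanced

section Phases
variable {u : Config} {i : ℤ} {k : ℕ}

lemma dfc_of_hits (hh : hits u i = true) : (u i).dfc = true := by
  rw [hits] at hh; grind

lemma fwS_of_hits (hh : hits u i = true) : (u (i - 1)).fwS = true := by
  rw [hits] at hh; grind

lemma fwS_of_hits_succ (hh : hits u (i + 1) = true) : (u i).fwS = true := by
  simpa using fwS_of_hits hh

lemma dfc_of_matchDefects (hd : (matchDefects u i).dfc = true) : (u i).dfc = true := by
  rw [matchDefects_dfc] at hd; grind

lemma sendForward_sta_of_not_dfc (hd : (u i).dfc = false) :
    (sendForward u i).sta = (u i).sta := by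
  simp [sendForward_sta, hd]

lemma reflected_bwS_of_backward (hb : (backward u k i).bwS = true) :
    (reflected u (i + k)).bwS = true := by
  induction k generalizing i with
  | zero => simpa [backward] using hb
  | succ k ih =>
    rw [backward_succ, backwardStep_bwS] at hb
    have := ih (i := i + 1) (by grind)
    rwa [Nat.cast_succ, add_comm (k : ℤ), ← add_assoc]

lemma backward_bwS_of_propagate (hb : (propagate u i).bwS = true) :
    (backward u 3 i).bwS = true := by
  have hs : ∀ k, (anti u (k + 1) i).bwS = true → (anti u k i).bwS = true := fun k hb => by
    rw [anti_succ, antiStep_bwS] at hb; grind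
  rw [propagate, antiLastStep_bwS] at hb
  have h0 : (emitted u i).bwS = true := hs 0 (hs 1 (by grind))
  rwa [emitted, sendAnti_bwS] at h0

lemma emitted_anS_of_anti (ha : (anti u k i).anS = true) : (emitted u (i - k)).anS = true := by
  induction k generalizing i with
  | zero => simpa [anti] using ha
  | succ k ih =>
    rw [anti_succ, antiStep_anS] at ha
    have := ih (i := i - 1) (by grind)
    rwa [Nat.cast_succ, add_comm (k : ℤ), ← sub_sub]

lemma anti_anS_of_propagate (ha : (propagate u i).anS = true) :
    (anti u 2 (i - 1)).anS = true := by
  rw [propagate, antiLastStep_anS] at ha; grind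

lemma emitted_anS_of_not_dfc (hd : (reflected u i).dfc = false)
    (hs : debt (backward u 3 i) ≠ 0) : (emitted u i).anS = true := by
  rw [debt] at hs
  rw [emitted, sendAnti_anS, backward_dfc, hd]
  cases ha : (backward u 3 i).anS
  · simpa [ha, Nat.pos_iff_ne_zero] using hs
  · rfl

lemma emitted_anS_of_dfc (hd : (reflected u i).dfc = true) (ha : (u i).anS = false) :
    (emitted u i).anS = false := by
  have h0 : (backward u 0 i).anS = false := (reflected_anS u i).trans ha
  have h3 : (backward u 3 i).anS = false :=
    Bool.eq_false_of_le_false (h0 ▸ antitone_backward_anS u i (Nat.zero_le 3))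
  simp [emitted, sendAnti_anS, hd, h3]

lemma emitted_sta_le : (emitted u i).sta ≤ (sendForward u i).sta := by
  have h3 : (backward u 3 i).sta ≤ (backward u 0 i).sta :=
    antitone_backward_sta u i (Nat.zero_le 3)
  have h0 : (backward u 0 i).sta = (sendForward u i).sta := reflected_sta u i
  rw [emitted, sendAnti_sta]
  split_ifs <;> omega

lemma debt_emitted_le_of_not_dfc (hd : (u i).dfc = false) : debt (emitted u i) ≤ debt (u i) := by
  have := debt_backward_le_sendForward u i 3
  rwa [← debt_emitted, debt, debt, sendForward_anS, sendForward_sta_of_not_dfc hd] at this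

end Phases

namespace Balanced
variable {h : ℤ → ℤ} {u : Config} {i : ℤ}

lemma bwS_eq_false_of_dfc (B : Balanced u h) (hd : (u i).dfc = true) : (u i).bwS = false := by
  refine Bool.eq_false_iff.2 fun hb => ?_
  have := B.one_le_of_bwS (i := i - 1) (by simpa using hb)
  have := B.height_of_dfc i hd
  omega

lemma not_dfc_of_hits_succ (B : Balanced u h) (hh : hits u (i + 1) = true) :
    (u i).dfc = false :=
  Bool.eq_false_iff.2 fun hd => by simpa [fwS_of_hits_succ hh] using B.fwS_of_dfc i hd

lemma hits_succ_of_dfc (B : Balanced u h) (hd : (u i).dfc = true) : hits u (i + 1) = false := by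
  simp [hits, B.fwS_of_dfc i hd]

lemma reflected_fwS_of_hits_succ (B : Balanced u h) (hh : hits u (i + 1) = true) :
    (reflected u i).fwS = false := by
  have := B.bwS_of_dfc _ (dfc_of_hits hh)
  rw [add_sub_cancel_right] at this
  simp [reflected_fwS, hh, this]

lemma reflected_fwS_of_hits (B : Balanced u h) (hh : hits u i = true) :
    (reflected u i).fwS = false := by
  simp [reflected_fwS, hh, B.bwS_eq_false_of_dfc (dfc_of_hits hh)]

lemma backwardHeight_one_of_hits (B : Balanced u h) (hh : hits u i = true) :
    backwardHeight h u 1 (i - 1) = 0 := by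
  have hf : (sendForward u (i - 1)).fwS = true := by rw [sendForward_fwS, fwS_of_hits hh]; rfl
  have hb : (backward u 0 i).bwS = true := by
    change (reflected u i).bwS = true
    simp [reflected_bwS, hh, hf]
  simp [backwardHeight, B.height_of_dfc i (dfc_of_hits hh), hf, hb]

/- The signal reflected at `i + 1` either meets a debt at `i`, or leaves `i` to the left; in both
cases nothing is left of the height at `i - 1`. -/
lemma backwardHeight_two_of_hits_succ (B : Balanced u h) (hh : hits u (i + 1) = true) :
    backwardHeight h u 2 (i - 1) = 0 := by
  have hd := dfc_of_hits hh
  have hf := fwS_of_hits_succ hh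
  have hb : (u i).bwS = false := by simpa using B.bwS_of_dfc _ hd
  have hi : 0 = h (i - 1) + charge (u i) := by
    rw [← B.height i]; simpa using (B.height_of_dfc _ hd).symm
  have hb0 : (backward u 0 i).bwS = (sendForward u (i - 1)).fwS := by
    change (reflected u i).bwS = _
    simp [reflected_bwS, hb, hh]
  have hb0' : (backward u 0 (i + 1)).bwS = true := by
    change (reflected u (i + 1)).bwS = true
    simp [reflected_bwS, hh, sendForward_fwS, hf]
  have hb1 : (backward u 1 i).bwS = decide (debt (u i) = 0) := by
    have hs : (backward u 0 i).sta = (u i).sta := by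
      change (reflected u i).sta = _
      rw [reflected_sta, sendForward_sta_of_not_dfc (B.not_dfc_of_hits_succ hh)]
    have ha : (backward u 0 i).anS = (u i).anS := reflected_anS u i
    simp [backward_succ, backwardStep_bwS, hb0', hs, ha, debt, and_comm]
  have h2 : backwardHeight h u 2 (i - 1) = h (i - 1) - (backward u 1 i).bwS.toNat := by
    simp [backwardHeight, hb0]
  have h2' := B.nonneg_backwardHeight 2 (i - 1)
  simp only [charge, hf, hb, Bool.toNat_true, Bool.toNat_false] at hi
  have := (backward u 1 i).bwS.toNat_le
  by_cases hz : debt (u i) = 0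
  · simp only [h2, hb1, hz, decide_true, Bool.toNat_true]
    omega
  · omega

lemma sendForward_fwS_of_not_hits (hd : (u i).dfc = true) (hh : hits u i = false) :
    (sendForward u (i - 1)).fwS = false := by
  rw [hits, hd] at hh
  rw [sendForward_fwS, sub_add_cancel]
  grind

lemma backwardHeight_two_of_reflected_dfc (B : Balanced u h) (hd : (reflected u i).dfc = true) :
    backwardHeight h u 2 (i - 1) = 0 := by
  by_cases hh : hits u (i + 1) = true
  · exact B.backwardHeight_two_of_hits_succ hh
  · rw [reflected_dfc] at hd
    have hd' : (u i).dfc = true := by grind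
    have hf := sendForward_fwS_of_not_hits hd' (by grind)
    have h0 : backwardHeight h u 0 (i - 1) = 0 := by
      simp [backwardHeight, hf, B.height_of_dfc i hd']
    exact le_antisymm (h0 ▸ antitone_backwardHeight (Nat.zero_le 2))
      (B.nonneg_backwardHeight 2 (i - 1))

lemma reflected_fwS_of_reflected_dfc (B : Balanced u h) (hd : (reflected u i).dfc = true) :
    (reflected u i).fwS = false := by
  by_cases hh : hits u (i + 1) = true
  · exact B.reflected_fwS_of_hits_succ hh
  · rw [reflected_dfc] at hd
    rw [reflected_fwS, sendForward_fwS_of_not_hits (by grind) (by grind), Bool.false_and]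

protected lemma matchDefects (B : Balanced u h) : Balanced (matchDefects u) h where
  height i := by rw [charge_matchDefects]; exact B.height i
  nonneg := B.nonneg
  debt_of_bwS i := by simpa using B.debt_of_bwS i
  height_of_dfc i hd := B.height_of_dfc i (dfc_of_matchDefects hd)
  fwS_of_dfc i hd := by simpa using B.fwS_of_dfc i (dfc_of_matchDefects hd)
  bwS_of_dfc i hd := by simpa using B.bwS_of_dfc i (dfc_of_matchDefects hd)
  anS_of_dfc i hd := by simpa using B.anS_of_dfc i (dfc_of_matchDefects hd)

lemma debt_propagate_of_bwS (hb : (propagate u i).bwS = true) : debt (propagate u i) = 0 := by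
  have h3 := backward_bwS_of_propagate hb
  rw [backward_succ] at h3
  have hs : debt (emitted u i) = 0 := by
    rw [debt_emitted, backward_succ, debt_backwardStep_of_bwS h3]
  rw [propagate, antiLastStep_bwS] at hb
  rw [debt_eq_zero, propagate_sta, propagate, antiLastStep_anS]
  exact ⟨(debt_eq_zero.1 hs).1, by grind⟩

protected lemma propagate (B : Balanced u h) : Balanced (propagate u) (antiHeight h u 3) where
  height := B.height.propagate
  nonneg := B.nonneg_antiHeight 3
  debt_of_bwS _ := debt_propagate_of_bwS
  height_of_dfc i hd := by
    rw [propagate_dfc] at hd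
    exact B.antiHeight_eq_zero (B.backwardHeight_two_of_reflected_dfc hd) (by norm_num)
  fwS_of_dfc i hd := by
    rw [propagate_dfc] at hd
    rw [propagate_fwS, B.reflected_fwS_of_reflected_dfc hd, Bool.false_and, Bool.false_and]
  bwS_of_dfc i hd := by
    rw [propagate_dfc] at hd
    have h2 := B.backward_bwS_of_height (B.backwardHeight_two_of_reflected_dfc hd)
    refine Bool.eq_false_iff.2 fun hb => ?_
    have h3 := backward_bwS_of_propagate hb
    rw [backward_succ, backwardStep_bwS, h2, Bool.false_and] at h3
    contradiction
  anS_of_dfc i hd := by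
    rw [propagate_dfc] at hd
    have ha : (anti u 2 (i - 1)).anS = false :=
      B.anti_anS_of_height (B.backwardHeight_two_of_reflected_dfc hd) (by norm_num)
    exact Bool.eq_false_iff.2 fun h2 => by simpa [ha] using anti_anS_of_propagate h2

/- Otherwise the debt which a hit defect leaves at `i` has been exhausted by the backward-signals,
although the height at `i` was kept positive by the debt accompanying the forward-signal. -/
lemma propagate_fwS_succ_of_hits (B : Balanced u h) (hh : hits u i = true) :
    (propagate u (i + 1)).fwS = false := by
  refine Bool.eq_false_iff.2 fun hf => ?_
  rw [propagate_fwS, add_sub_cancel_right] at hf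
  have hr : (reflected u (i + 1)).fwS = true := by grind
  have ha : (emitted u i).anS = false := by
    change (anti u 0 i).anS = false
    grind
  have hn := B.hits_succ_of_dfc (dfc_of_hits hh)
  have hd : debt (backward u 3 i) = 0 := by
    by_contra hd
    simp [emitted_anS_of_not_dfc (by simp [reflected_dfc, hn, hh]) hd] at ha
  have hl : backwardHeight h u 3 (i - 1) ≤ 0 :=
    B.backwardHeight_one_of_hits hh ▸ antitone_backwardHeight (by norm_num)
  have hi := B.height.backward 3 i
  have hi' := B.height.backward 3 (i + 1)
  have h0 := B.nonneg_backwardHeight 3 (i + 1)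
  have h1 := B.one_le_backwardHeight_of_debt hr 3
  rw [add_sub_cancel_right] at hi'
  simp only [charge, backward_fwS, hr, hd, Bool.toNat_true] at hi hi'
  omega

end Balanced

namespace Confined
variable {a b r : ℤ} {h : ℤ → ℤ} {u : Config} {i : ℤ}

protected lemma matchDefects (C : Confined a b r u h) : Confined a b r (matchDefects u) h where
  left i hi := by
    have hd := matchDefects_dfc u i
    have h0 := C.left i hi
    ext <;> simp [hd, h0, Site.zero]
  height_left := C.height_left
  height_right := C.height_right
  dfc_le i hd := C.dfc_le i (dfc_of_matchDefects hd)
  sta_le := by simpa using C.sta_le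
  bwS_le := by simpa using C.bwS_le
  fwS_le := by simpa using C.fwS_le
  le := C.le

lemma le_of_sendForward_fwS (C : Confined a b r u h) (hf : (sendForward u i).fwS = true) :
    i ≤ r := by
  rw [sendForward_fwS] at hf
  by_cases hu : (u i).fwS = true
  · exact C.fwS_le i hu
  · exact (C.dfc_le i (by grind)).trans C.le

lemma le_of_reflected_bwS (C : Confined a b r u h) (hb : (reflected u i).bwS = true) :
    i ≤ b := by
  rw [reflected_bwS] at hb
  by_cases hu : (u i).bwS = true
  · exact C.bwS_le i hu
  · by_cases hh : hits u i = true
    · exact C.dfc_le i (dfc_of_hits hh)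
    · have := C.dfc_le (i + 1) (dfc_of_hits (by grind))
      omega

lemma le_of_propagate_sta (C : Confined a b r u h) (hs : 0 < (propagate u i).sta) :
    i ≤ b := by
  rw [propagate_sta] at hs
  have hs' := hs.trans_le emitted_sta_le
  cases hd : (u i).dfc with
  | true => exact C.dfc_le i hd
  | false => exact C.sta_le i (by rwa [sendForward_sta_of_not_dfc hd] at hs')

lemma backwardHeight_zero_left (C : Confined a b r u h) (hi : i < a) :
    backwardHeight h u 0 i = 0 := by
  have h0 := C.left i hi
  simp [backwardHeight, C.height_left i hi, sendForward_fwS, h0, Site.zero]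

lemma debt_emitted_left (C : Confined a b r u h) (hi : i < a) : debt (emitted u i) = 0 := by
  have h0 := C.left i hi
  have := debt_emitted_le_of_not_dfc (u := u) (i := i) (by simp [h0, Site.zero])
  simpa [debt, h0, Site.zero] using this

lemma propagate_left (B : Balanced u h) (C : Confined a b r u h) (hi : i < a) :
    propagate u i = Site.zero := by
  have h0 := C.left i hi
  have h1 := C.left (i - 1) (by omega)
  have hz := C.backwardHeight_zero_left hi
  have hh : hits u (i + 1) = false := Bool.eq_false_iff.2 fun hh => by
    simpa [h0, Site.zero] using fwS_of_hits_succ hh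
  have hf : (reflected u i).fwS = false := by simp [reflected_fwS, sendForward_fwS, h1, Site.zero]
  ext
  · simp [reflected_dfc, hh, h0, Site.zero]
  · simp [propagate_fwS, hf, Site.zero]
  · refine Bool.eq_false_iff.2 fun hb => ?_
    have h2 : (backward u 2 (i + 1)).bwS = true := by
      have h3 := backward_bwS_of_propagate hb
      rw [backward_succ, backwardStep_bwS] at h3
      grind
    have := B.one_le_backwardHeight_of_bwS h2
    have : backwardHeight h u 2 i ≤ 0 := hz ▸ antitone_backwardHeight (Nat.zero_le 2)
    omega
  · refine Bool.eq_false_iff.2 fun ha => ?_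
    have h3 := emitted_anS_of_anti (anti_anS_of_propagate ha)
    rw [(debt_eq_zero.1 (C.debt_emitted_left (by omega))).2] at h3
    contradiction
  · rw [propagate_sta, (debt_eq_zero.1 (C.debt_emitted_left hi)).1, Site.zero]

protected lemma propagate (B : Balanced u h) (C : Confined a b r u h) :
    Confined a b (r + 1) (propagate u) (antiHeight h u 3) where
  left i hi := C.propagate_left B hi
  height_left i hi := B.antiHeight_eq_zero (C.backwardHeight_zero_left hi) (Nat.zero_le 3)
  height_right i hi := by
    have hf : (sendForward u i).fwS = false := Bool.eq_false_iff.2 fun hf => by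
      have := C.le_of_sendForward_fwS hf
      omega
    exact B.antiHeight_eq_zero (l := 0)
      (by simp [backwardHeight, C.height_right i (by omega), hf]) (Nat.zero_le 3)
  dfc_le i hd := by
    rw [propagate_dfc, reflected_dfc] at hd
    by_cases hh : hits u (i + 1) = true
    · have := C.dfc_le _ (dfc_of_hits hh)
      omega
    · exact C.dfc_le i (by grind)
  sta_le i := C.le_of_propagate_sta
  bwS_le i hb := by
    have := C.le_of_reflected_bwS (reflected_bwS_of_backward (backward_bwS_of_propagate hb))
    push_cast at this
    omega
  fwS_le i hf := by
    rw [propagate_fwS, reflected_fwS] at hf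
    have := C.le_of_sendForward_fwS (i := i - 1) (by grind)
    omega
  le := C.le.trans (by omega)

end Confined

/-- `c i` is the parity of the number of defects of `u` at the sites `≤ i`, of which there are
finitely many, located in `[a, b]`, and an even number in total. -/
structure Parity (a b : ℤ) (u : Config) (c : ℤ → Bool) : Prop where
  step : ∀ i, c i = (c (i - 1) ^^ (u i).dfc)
  left : ∀ i < a, c i = false
  right : ∀ i, b ≤ i → c i = false

/-- The parity of the defects after their matching. -/
def matchParity (u : Config) (c : ℤ → Bool) (i : ℤ) : Bool := c i ^^ cor u i

/-- The parity of the defects after an iteration without matching. -/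
def propagateParity (u : Config) (c : ℤ → Bool) (i : ℤ) : Bool := c i ^^ hits u (i + 1)

/-- The structure of a configuration behind the front `q`: the sites between a defect of odd rank
and the next defect hold a forward-signal and, except at the front, no debt; elsewhere there is no
forward-signal; of two adjacent defects, the first one has odd rank. -/
structure Behind (u : Config) (c : ℤ → Bool) (q : ℤ) : Prop where
  fwS_of_odd : ∀ i ≤ q, c i = true → (u i).dfc = false → (u i).fwS = true
  debt_of_odd : ∀ i < q, c i = true → (u i).dfc = false → debt (u i) = 0
  fwS_of_even : ∀ i ≤ q, c i = false → (u i).fwS = false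
  odd_of_adjacent : ∀ i < q, (u i).dfc = true → (u (i + 1)).dfc = true → c i = true

/-- The front after the matching: it is moved out of a matched pair. -/
def matchFront (u : Config) (c : ℤ → Bool) (q : ℤ) : ℤ :=
  if cor u q then (if c q then q + 1 else q - 1) else q

lemma le_of_le_matchFront {u : Config} {c : ℤ → Bool} {q i : ℤ} (hi : i ≤ matchFront u c q) :
    i ≤ q ∨ cor u q = true ∧ c q = true ∧ i = q + 1 := by
  rw [matchFront] at hi
  split_ifs at hi with hcor hc
  · exact or_iff_not_imp_left.2 fun hq => ⟨hcor, hc, by omega⟩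
  all_goals exact Or.inl (by omega)

section Cor
variable {u : Config} {i : ℤ}

lemma dfc_of_cor (hc : cor u i = true) : (u i).dfc = true := by
  rw [cor] at hc; grind

lemma dfc_succ_of_cor (hc : cor u i = true) : (u (i + 1)).dfc = true := by
  rw [cor] at hc; grind

lemma cor_succ_of_dfc (hd : (u i).dfc = true) : cor u (i + 1) = false := by
  simp [cor, hd]

end Cor

namespace Parity
variable {a b r : ℤ} {u : Config} {h : ℤ → ℤ} {c : ℤ → Bool}

lemma step_succ (P : Parity a b u c) (i : ℤ) : c (i + 1) = (c i ^^ (u (i + 1)).dfc) := by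
  rw [P.step (i + 1), add_sub_cancel_right]

protected lemma matchDefects (P : Parity a b u c) (C : Confined a b r u h) :
    Parity a b (matchDefects u) (matchParity u c) where
  step i := by
    have := P.step i
    simp only [matchParity, matchDefects_dfc, cor, sub_add_cancel] at this ⊢
    grind
  left i hi := by simp [matchParity, P.left i hi, cor, C.left i hi, Site.zero]
  right i hi := by
    have : (u (i + 1)).dfc = false := Bool.eq_false_iff.2 fun hd => by
      have := C.dfc_le (i + 1) hd
      omega
    simp [matchParity, P.right i hi, cor, this]

protected lemma propagate (P : Parity a b u c) (B : Balanced u h) (C : Confined a b r u h) :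
    Parity a b (propagate u) (propagateParity u c) where
  step i := by
    have := P.step i
    have h0 := B.not_dfc_of_hits_succ (i := i)
    have h1 := dfc_of_hits (u := u) (i := i)
    simp only [propagateParity, propagate_dfc, reflected_dfc, sub_add_cancel]
    grind
  left i hi := by simp [propagateParity, P.left i hi, hits, C.left i hi, Site.zero]
  right i hi := by
    have : hits u (i + 1) = false := Bool.eq_false_iff.2 fun hh => by
      have := C.dfc_le _ (dfc_of_hits hh)
      omega
    simp [propagateParity, P.right i hi, this]

end Parity

namespace Behind
variable {a b r q i : ℤ} {u : Config} {h : ℤ → ℤ} {c : ℤ → Bool}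

lemma odd_of_cor (F : Behind u c q) (hi : i ≤ matchFront u c q) (hcor : cor u i = true) :
    c i = true := by
  rcases le_of_le_matchFront hi with hq | ⟨hcq, -, rfl⟩
  · rcases hq.lt_or_eq with hq | rfl
    · exact F.odd_of_adjacent i hq (dfc_of_cor hcor) (dfc_succ_of_cor hcor)
    · by_contra hc
      simp [matchFront, hcor, hc] at hi
  · simp [cor_succ_of_dfc (dfc_of_cor hcq)] at hcor

lemma cor_of_matchParity (F : Behind u c q) (hi : i ≤ matchFront u c q)
    (hc : matchParity u c i = true) : cor u i = false :=
  Bool.eq_false_iff.2 fun hcor => by simp [matchParity, hcor, F.odd_of_cor hi hcor] at hc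

lemma odd_of_matchParity (F : Behind u c q) (hi : i ≤ matchFront u c q)
    (hc : matchParity u c i = true) : c i = true := by
  simpa [matchParity, F.cor_of_matchParity hi hc] using hc

lemma le_of_matchParity (F : Behind u c q) (P : Parity a b u c) (hi : i ≤ matchFront u c q)
    (hc : matchParity u c i = true) : i ≤ q := by
  rcases le_of_le_matchFront hi with hq | ⟨hcor, hcq, rfl⟩
  · exact hq
  · simpa [P.step_succ q, hcq, dfc_succ_of_cor hcor] using F.odd_of_matchParity hi hc

lemma lt_of_matchParity (F : Behind u c q) (P : Parity a b u c) (hi : i < matchFront u c q)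
    (hc : matchParity u c i = true) : i < q := by
  refine (F.le_of_matchParity P hi.le hc).lt_of_ne ?_
  rintro rfl
  simp [matchFront, F.cor_of_matchParity hi.le hc] at hi

lemma dfc_of_matchParity (F : Behind u c q) (P : Parity a b u c) (hi : i ≤ matchFront u c q)
    (hc : matchParity u c i = true) (hd : (matchDefects u i).dfc = false) :
    (u i).dfc = false := by
  refine Bool.eq_false_iff.2 fun hdi => ?_
  have hcor : cor u (i - 1) = true := by
    simpa [matchDefects_dfc, hdi, F.cor_of_matchParity hi hc] using hd
  have hq := F.le_of_matchParity P hi hc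
  have hc' := F.odd_of_adjacent (i - 1) (by omega) (dfc_of_cor hcor) (by rwa [sub_add_cancel])
  simpa [P.step i, hc', hdi] using F.odd_of_matchParity hi hc

/- A third defect next to `i` and `i + 1` would make two consecutive defects of odd rank. -/
lemma matchDefects_not_adjacent (F : Behind u c q) (P : Parity a b u c)
    (hi : i ≤ matchFront u c q) (hd : (matchDefects u i).dfc = true) :
    (matchDefects u (i + 1)).dfc = false := by
  refine Bool.eq_false_iff.2 fun hd' => ?_
  have hq : i ≤ q := by
    rcases le_of_le_matchFront hi with hq | ⟨hcor, -, rfl⟩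
    · exact hq
    · simp [matchDefects_dfc, hcor] at hd
  have hdi := dfc_of_matchDefects hd
  have h1 : (u (i - 1)).dfc = true := by
    rw [matchDefects_dfc, cor, dfc_of_matchDefects hd'] at hd
    grind
  have h2 : (u (i - 1 - 1)).dfc = true := by
    rw [matchDefects_dfc, cor.eq_1 u (i - 1), sub_add_cancel, h1, hdi] at hd
    grind
  have c1 := F.odd_of_adjacent (i - 1) (by omega) h1 (by rwa [sub_add_cancel])
  have c2 := F.odd_of_adjacent (i - 1 - 1) (by omega) h2 (by rwa [sub_add_cancel])
  simpa [c1, c2, h1] using P.step (i - 1)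

protected lemma matchDefects (F : Behind u c q) (P : Parity a b u c) (B : Balanced u h) :
    Behind (matchDefects u) (matchParity u c) (matchFront u c q) where
  fwS_of_odd i hi hc hd := by
    rw [matchDefects_fwS]
    exact F.fwS_of_odd i (F.le_of_matchParity P hi hc) (F.odd_of_matchParity hi hc)
      (F.dfc_of_matchParity P hi hc hd)
  debt_of_odd i hi hc hd := by
    rw [debt_matchDefects]
    exact F.debt_of_odd i (F.lt_of_matchParity P hi hc) (F.odd_of_matchParity hi.le hc)
      (F.dfc_of_matchParity P hi.le hc hd)
  fwS_of_even i hi hc := by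
    rw [matchDefects_fwS]
    cases hcor : cor u i with
    | true => exact B.fwS_of_dfc i (dfc_of_cor hcor)
    | false =>
      rcases le_of_le_matchFront hi with hq | ⟨hcor', -, rfl⟩
      · exact F.fwS_of_even i hq (by simpa [matchParity, hcor] using hc)
      · exact B.fwS_of_dfc _ (dfc_succ_of_cor hcor')
  odd_of_adjacent i hi hd hd' := by
    simp [F.matchDefects_not_adjacent P hi.le hd] at hd'

end Behind

/-- No two defects are adjacent, up to the site `q`. This holds behind the front after the
matching. -/
def Separated (u : Config) (q : ℤ) : Prop :=
  ∀ i ≤ q, (u i).dfc = true → (u (i + 1)).dfc = false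

lemma propagateParity_of_hits {u : Config} {c : ℤ → Bool} {i : ℤ} (hh : hits u (i + 1) = true)
    (hc : c i = true) : propagateParity u c i = false := by
  simp [propagateParity, hh, hc]

lemma propagateParity_of_not_hits {u : Config} {c : ℤ → Bool} {i : ℤ}
    (hh : hits u (i + 1) = false) : propagateParity u c i = c i := by
  simp [propagateParity, hh]

lemma propagate_fwS_of_dfc {u : Config} {i : ℤ} (hd : (u (i - 1)).dfc = false)
    (hf : (u (i - 1)).fwS = false) : (propagate u i).fwS = false := by
  simp [propagate_fwS, reflected_fwS, sendForward_fwS, hd, hf]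

namespace Behind
variable {a b r q i : ℤ} {u : Config} {h : ℤ → ℤ} {c : ℤ → Bool}

protected lemma matchDefects_separated (F : Behind u c q) (P : Parity a b u c) :
    Separated (matchDefects u) (matchFront u c q) :=
  fun _ hi hd => F.matchDefects_not_adjacent P hi hd

lemma succ (F : Behind u c q)
    (hodd : c (q + 1) = true → (u (q + 1)).dfc = false → (u (q + 1)).fwS = true)
    (hdebt : c q = true → (u q).dfc = false → debt (u q) = 0)
    (heven : c (q + 1) = false → (u (q + 1)).fwS = false)
    (hadj : (u q).dfc = true → (u (q + 1)).dfc = true → c q = true) : Behind u c (q + 1) where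
  fwS_of_odd i hi := by
    rcases hi.lt_or_eq with hi | rfl
    exacts [F.fwS_of_odd i (by omega), hodd]
  debt_of_odd i hi := by
    rcases (show i ≤ q by omega).lt_or_eq with hi | rfl
    exacts [F.debt_of_odd i hi, hdebt]
  fwS_of_even i hi := by
    rcases hi.lt_or_eq with hi | rfl
    exacts [F.fwS_of_even i (by omega), heven]
  odd_of_adjacent i hi := by
    rcases (show i ≤ q by omega).lt_or_eq with hi | rfl
    exacts [F.odd_of_adjacent i hi, hadj]

lemma hits_of_even (F : Behind u c q) (hi : i ≤ q) (hc : c i = false) :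
    hits u (i + 1) = false := by
  simp [hits, F.fwS_of_even i hi hc]

lemma hits_of_odd (F : Behind u c q) (S : Separated u q) (hi : i ≤ q) (hc : c i = true)
    (hd : (u (i + 1)).dfc = true) : hits u (i + 1) = true := by
  have hdi : (u i).dfc = false := Bool.eq_false_iff.2 fun hdi => by simp [S i hi hdi] at hd
  simp [hits, hd, F.fwS_of_odd i hi hc hdi]

lemma hits_of_even_dfc (F : Behind u c q) (P : Parity a b u c) (S : Separated u q)
    (hi : i - 1 ≤ q) (hc : c i = false) (hd : (u i).dfc = true) : hits u i = true := by
  have hc' := P.step i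
  rw [hc, hd] at hc'
  simpa using F.hits_of_odd S hi (by simpa using hc') (by simpa using hd)

lemma hits_of_odd_dfc (F : Behind u c q) (P : Parity a b u c) (hi : i - 1 ≤ q)
    (hc : c i = true) (hd : (u i).dfc = true) : hits u i = false := by
  have hc' := P.step i
  rw [hc, hd] at hc'
  simpa using F.hits_of_even hi (by simpa using hc')

section Odd

lemma hits_succ_of_propagateParity (hd : (reflected u i).dfc = false) : hits u (i + 1) = false := by
  rw [reflected_dfc] at hd; grind

lemma odd_of_propagateParity (hc : propagateParity u c i = true)
    (hd : (reflected u i).dfc = false) : c i = true :=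
  (propagateParity_of_not_hits (c := c) (hits_succ_of_propagateParity hd)).symm.trans hc

lemma dfc_of_propagateParity (F : Behind u c q) (P : Parity a b u c) (hi : i ≤ q)
    (hc : propagateParity u c i = true) (hd : (reflected u i).dfc = false) :
    (u i).dfc = false :=
  Bool.eq_false_iff.2 fun hdi => by
    have := F.hits_of_odd_dfc P (by omega) (odd_of_propagateParity hc hd) hdi
    simp [reflected_dfc, hdi, this] at hd

lemma odd_pred_of_propagateParity (F : Behind u c q) (P : Parity a b u c) (hi : i ≤ q)
    (hc : propagateParity u c i = true) (hd : (reflected u i).dfc = false) :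
    c (i - 1) = true := by
  have := P.step i
  rw [odd_of_propagateParity hc hd, F.dfc_of_propagateParity P hi hc hd] at this
  simpa using this.symm

lemma propagateParity_pred (F : Behind u c q) (P : Parity a b u c) (hi : i ≤ q)
    (hc : propagateParity u c i = true) (hd : (reflected u i).dfc = false) :
    propagateParity u c (i - 1) = true := by
  have hh : hits u (i - 1 + 1) = false := by
    simp [hits, F.dfc_of_propagateParity P hi hc hd]
  rw [propagateParity_of_not_hits hh]
  exact F.odd_pred_of_propagateParity P hi hc hd

lemma emitted_anS_pred (F : Behind u c q) (P : Parity a b u c) (B : Balanced u h)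
    (hi : i ≤ q) (hc : propagateParity u c i = true) (hd : (reflected u i).dfc = false) :
    (emitted u (i - 1)).anS = false := by
  have hc' := F.odd_pred_of_propagateParity P hi hc hd
  cases hd' : (u (i - 1)).dfc with
  | true =>
    have hh := F.hits_of_odd_dfc P (by omega) hc' hd'
    exact emitted_anS_of_dfc (by simp [reflected_dfc, hd', hh]) (B.anS_of_dfc _ hd')
  | false =>
    have hs := F.debt_of_odd (i - 1) (by omega) hc' hd'
    have := debt_emitted_le_of_not_dfc hd'
    exact (debt_eq_zero.1 (by omega)).2

lemma anti_anS_pred (F : Behind u c q) (P : Parity a b u c) (B : Balanced u h) (hi : i ≤ q)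
    (hc : propagateParity u c i = true) (k : ℕ) : (anti u k (i - 1)).anS = false := by
  induction k generalizing i with
  | zero =>
    cases hd : (reflected u i).dfc with
    | true => exact B.anti_anS_of_height (B.backwardHeight_two_of_reflected_dfc hd) (by norm_num)
    | false => exact F.emitted_anS_pred P B hi hc hd
  | succ k ih =>
    cases hd : (reflected u i).dfc with
    | true => exact B.anti_anS_of_height (B.backwardHeight_two_of_reflected_dfc hd) (by norm_num)
    | false =>
      have := ih (i := i - 1) (by omega) (F.propagateParity_pred P hi hc hd)
      simp [anti_succ, antiStep_anS, this]

lemma propagate_anS (F : Behind u c q) (P : Parity a b u c) (B : Balanced u h) (hi : i ≤ q)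
    (hc : propagateParity u c i = true) : (propagate u i).anS = false := by
  simp [propagate, antiLastStep_anS, F.anti_anS_pred P B hi hc 2]

lemma debt_propagate (F : Behind u c q) (P : Parity a b u c) (B : Balanced u h) (hi : i ≤ q)
    (hc : propagateParity u c i = true) (hs : debt (backward u 3 i) = 0) :
    debt (propagate u i) = 0 := by
  rw [← debt_emitted, debt_eq_zero] at hs
  rw [debt_eq_zero, propagate_sta]
  exact ⟨hs.1, F.propagate_anS P B hi hc⟩

lemma sendForward_fwS_of_odd (F : Behind u c q) (hi : i ≤ q) (hc : c i = true)
    (hd : (u (i + 1)).dfc = false) : (sendForward u i).fwS = true := by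
  have := F.fwS_of_odd i hi hc
  rw [sendForward_fwS, hd]
  grind

end Odd

lemma propagate_odd_of_adjacent (F : Behind u c q) (P : Parity a b u c) (B : Balanced u h)
    (S : Separated u q) (hi : i ≤ q) (hd : (propagate u i).dfc = true)
    (hd' : (propagate u (i + 1)).dfc = true) : propagateParity u c i = true := by
  rw [propagate_dfc, reflected_dfc] at hd hd'
  have hh : hits u (i + 1) = false := Bool.eq_false_iff.2 fun hh => by
    simp [hh, B.hits_succ_of_dfc (dfc_of_hits hh)] at hd'
  rw [propagateParity_of_not_hits hh]
  by_contra hc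
  have hdi : (u i).dfc = true := by grind
  have := F.hits_of_even_dfc P S (by omega) (by simpa using hc) hdi
  simp [hh, this] at hd

lemma propagate_fwS_of_even (F : Behind u c q) (P : Parity a b u c) (B : Balanced u h)
    (S : Separated u q) (hi : i - 1 ≤ q) (hc : c (i - 1) = false) :
    (propagate u i).fwS = false := by
  cases hd' : (u (i - 1)).dfc with
  | true =>
    have hh := F.hits_of_even_dfc P S (by omega) hc hd'
    simpa using B.propagate_fwS_succ_of_hits hh
  | false => exact propagate_fwS_of_dfc hd' (F.fwS_of_even _ hi hc)

protected lemma propagate (F : Behind u c q) (P : Parity a b u c) (B : Balanced u h)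
    (S : Separated u q) : Behind (propagate u) (propagateParity u c) q where
  fwS_of_odd i hi hc hd := by
    rw [propagate_dfc] at hd
    have hdi := F.dfc_of_propagateParity P hi hc hd
    have hf := F.sendForward_fwS_of_odd (i := i - 1) (by omega)
      (F.odd_pred_of_propagateParity P hi hc hd) (by rwa [sub_add_cancel])
    have hh : hits u i = false := by simp [hits, hdi]
    simp [propagate_fwS, reflected_fwS, hf, hh, hits_succ_of_propagateParity hd,
      F.anti_anS_pred P B hi hc]
  debt_of_odd i hi hc hd := by
    rw [propagate_dfc] at hd
    have hdi := F.dfc_of_propagateParity P hi.le hc hd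
    have := F.debt_of_odd i hi (odd_of_propagateParity hc hd) hdi
    have := debt_emitted_le_of_not_dfc hdi
    rw [debt_emitted] at this
    exact F.debt_propagate P B hi.le hc (by omega)
  fwS_of_even i hi hc := by
    cases hc' : c (i - 1) with
    | false => exact F.propagate_fwS_of_even P B S (by omega) hc'
    | true =>
      by_cases hd : (propagate u i).dfc = true
      · exact B.propagate.fwS_of_dfc i hd
      have hh : hits u (i + 1) = false := by
        rw [propagate_dfc, reflected_dfc] at hd; grind
      have hdi : (u i).dfc = true := by
        have := P.step i
        rw [propagateParity_of_not_hits hh] at hc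
        simpa [hc, hc'] using this
      have hr := B.reflected_fwS_of_hits (F.hits_of_even_dfc P S (by omega)
        ((propagateParity_of_not_hits hh).symm.trans hc) hdi)
      simp [propagate_fwS, hr]
  odd_of_adjacent _ hi := F.propagate_odd_of_adjacent P B S hi.le

lemma propagateParity_of_even (F : Behind u c q) (hc : c q = false) :
    propagateParity u c q = false := by
  rw [propagateParity_of_not_hits (F.hits_of_even le_rfl hc), hc]

lemma propagate_succ_of_even (F : Behind u c q) (P : Parity a b u c) (B : Balanced u h)
    (C : Confined a b r u h) (S : Separated u q) (hc : c q = false) :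
    Behind (propagate u) (propagateParity u c) (q + 1) := by
  have hq := F.propagateParity_of_even hc
  refine (F.propagate P B S).succ (fun ho hd => ?_) (fun ho => by simp [hq] at ho)
    (fun _ => F.propagate_fwS_of_even P B S (by omega) (by simpa using hc))
    (F.propagate_odd_of_adjacent P B S le_rfl)
  have := (P.propagate B C).step_succ q
  simp only [hq, hd, ho] at this
  contradiction

lemma propagateParity_of_contact (P : Parity a b u c) (B : Balanced u h) (hc : c q = true)
    (hd : (u (q + 1)).dfc = true) : propagateParity u c (q + 1) = false := by
  rw [propagateParity_of_not_hits (B.hits_succ_of_dfc hd), P.step_succ q, hc, hd]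
  rfl

lemma propagate_succ_of_contact (F : Behind u c q) (P : Parity a b u c) (B : Balanced u h)
    (S : Separated u q) (hc : c q = true) (hd : (u (q + 1)).dfc = true) :
    Behind (propagate u) (propagateParity u c) (q + 1) := by
  have hh := F.hits_of_odd S le_rfl hc hd
  refine (F.propagate P B S).succ
    (fun ho => by simp [propagateParity_of_contact P B hc hd] at ho)
    (fun ho => by simp [propagateParity_of_hits hh hc] at ho)
    (fun _ => ?_) (F.propagate_odd_of_adjacent P B S le_rfl)
  simp [propagate_fwS, B.reflected_fwS_of_hits hh]

lemma parity_of_contact_two (P : Parity a b u c) (B : Balanced u h) (hc : c q = true)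
    (hh : hits u (q + 1 + 1) = true) : c (q + 1) = true ∧ c (q + 1 + 1) = false := by
  have h1 : c (q + 1) = true := by rw [P.step_succ q, hc, B.not_dfc_of_hits_succ hh]; rfl
  exact ⟨h1, by rw [P.step_succ (q + 1), h1, dfc_of_hits hh]; rfl⟩

lemma propagateParity_of_contact_two (P : Parity a b u c) (B : Balanced u h)
    (hc : c q = true) (hh : hits u (q + 1 + 1) = true) :
    propagateParity u c (q + 1 + 1) = false := by
  rw [propagateParity_of_not_hits (B.hits_succ_of_dfc (dfc_of_hits hh)),
    (parity_of_contact_two P B hc hh).2]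

/- The signal reflected by the defect at `q + 2` leaves no height, and hence no debt, at `q`. -/
lemma propagate_succ_of_contact_two (F : Behind u c q) (P : Parity a b u c) (B : Balanced u h)
    (S : Separated u q) (hc : c q = true) (hh : hits u (q + 1 + 1) = true) :
    Behind (propagate u) (propagateParity u c) (q + 1 + 1) := by
  have p1 := propagateParity_of_hits hh (parity_of_contact_two P B hc hh).1
  have p2 := propagateParity_of_contact_two P B hc hh
  have hd : (reflected u (q + 1 + 1)).dfc = false := by
    simp [reflected_dfc, hh, B.hits_succ_of_dfc (dfc_of_hits hh)]
  refine ((F.propagate P B S).succ (fun ho => by simp [p1] at ho) (fun ho hq => ?_) (fun _ => ?_)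
    (F.propagate_odd_of_adjacent P B S le_rfl)).succ (fun ho => by simp [p2] at ho)
    (fun ho => by simp [p1] at ho) (fun _ => ?_) (fun _ hd' => by simp [hd] at hd')
  · have ha : (emitted u q).anS = false := by
      have h0 := B.backwardHeight_two_of_hits_succ hh
      rw [add_sub_cancel_right] at h0
      exact B.anti_anS_of_height (k := 0) h0 (by norm_num)
    rw [propagate_dfc] at hq
    refine F.debt_propagate P B le_rfl ho ?_
    by_contra hs
    simp [emitted_anS_of_not_dfc hq hs] at ha
  · simp [propagate_fwS, B.reflected_fwS_of_hits_succ hh]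
  · simp [propagate_fwS, B.reflected_fwS_of_hits hh]

lemma emitted_anS_of_debt (B : Balanced u h) (hh : hits u (q + 1) = false)
    (hs : (reflected u q).dfc = false → debt (backward u 3 q) = 0) :
    (emitted u q).anS = false := by
  cases hd : (reflected u q).dfc with
  | true =>
    refine emitted_anS_of_dfc hd (B.anS_of_dfc q ?_)
    rw [reflected_dfc, hh] at hd
    grind
  | false => exact (debt_eq_zero.1 ((debt_emitted u q).trans (hs hd))).2

lemma propagate_succ_of_debt (F : Behind u c q) (P : Parity a b u c) (B : Balanced u h)
    (S : Separated u q) (hc : c q = true) (hd : (u (q + 1)).dfc = false)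
    (hh : hits u (q + 1 + 1) = false)
    (hs : (reflected u q).dfc = false → debt (backward u 3 q) = 0) :
    Behind (propagate u) (propagateParity u c) (q + 1) := by
  have hh' : hits u (q + 1) = false := by simp [hits, hd]
  have p0 : propagateParity u c q = true := (propagateParity_of_not_hits hh').trans hc
  have p1 : propagateParity u c (q + 1) = true := by
    rw [propagateParity_of_not_hits hh, P.step_succ q, hc, hd]
    rfl
  have ha : (anti u 0 q).anS = false := emitted_anS_of_debt B hh' hs
  have ha' : (anti u 1 q).anS = false := by
    simp [anti_succ, antiStep_anS, F.anti_anS_pred P B le_rfl p0]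
  refine (F.propagate P B S).succ (fun _ _ => ?_) (fun _ hq => ?_) (fun ho => by simp [p1] at ho)
    (F.propagate_odd_of_adjacent P B S le_rfl)
  · simp [propagate_fwS, reflected_fwS, F.sendForward_fwS_of_odd le_rfl hc hd, hh, hh', ha, ha']
  · rw [propagate_dfc] at hq
    exact F.debt_propagate P B le_rfl p0 (hs hq)

end Behind

lemma sum_Ico_add_one (f : ℤ → ℕ) {m n : ℤ} (hmn : m ≤ n) :
    ∑ i ∈ Finset.Ico m (n + 1), f i = ∑ i ∈ Finset.Ico m n, f i + f n := by
  rw [← Finset.insert_Ico_right_eq_Ico_add_one hmn, Finset.sum_insert (by simp), add_comm]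

lemma IsHeight.sum_debt_le {h : ℤ → ℤ} {u : Config} (H : IsHeight h u) {m n : ℤ} (hmn : m ≤ n) :
    ((∑ i ∈ Finset.Ico m n, debt (u i) : ℕ) : ℤ) ≤ h (n - 1) - h (m - 1) + 2 * (n - m) := by
  induction n, hmn using Int.leInduction with
  | base => simp
  | succ n hn ih =>
    have := H n
    have := Bool.toNat_le (u n).fwS
    have := Bool.toNat_le (u n).bwS
    rw [sum_Ico_add_one _ hn, add_sub_cancel_right]
    simp only [charge] at *
    omega

/-- The number of pairs of adjacent sites, moving with the forward-signals, that hold a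
forward-signal in `[m, n)` at time `t`. -/
noncomputable def blocks (t : ℤ) (u : Config) (m n : ℤ) : ℕ :=
  (((Finset.Ico m n).filter fun i => (u i).fwS = true).image fun i => (t - i) / 2).card

/-- The debts in `[q, y)`, except those of a defect at `q`. -/
noncomputable def load (u : Config) (q y : ℤ) : ℕ :=
  (if (u q).dfc then 0 else debt (u q)) + ∑ i ∈ Finset.Ico (q + 1) y, debt (u i)

/-- `y` is the first defect after `q`. -/
structure Next (u : Config) (q y : ℤ) : Prop where
  lt : q < y
  dfc : (u y).dfc = true
  not_dfc : ∀ i, q < i → i < y → (u i).dfc = false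

/-- A bound on the time that a front at a site `q` of odd parity needs to pass all the defects,
where `y` is the first defect after `q`: each debt in front of it may delay it by one iteration,
and the defect `y` moves to the left at most once per block of forward-signals that reaches it. -/
noncomputable def potential (t b : ℤ) (u : Config) (q y : ℤ) : ℤ :=
  (b - q) + 4 * (b - y) + 4 * blocks t u (q + 1) y + load u q y

/-- The state of the front `q` at time `t`, with a bound `T` on the time that it needs to pass all
the defects. -/
structure Front (t b : ℤ) (u : Config) (c : ℤ → Bool) (q T : ℤ) : Prop where
  behind : Behind u c q
  even : c q = false → 5 * (b - q) ≤ T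
  odd : c q = true → ∃ y, Next u q y ∧ potential t b u q y ≤ T

section Potential
variable {a b r t q y : ℤ} {u : Config} {h : ℤ → ℤ} {c : ℤ → Bool}

lemma two_mul_blocks_le {m n : ℤ} (hmn : m ≤ n) : 2 * (blocks t u m n : ℤ) ≤ n - m + 2 := by
  have : blocks t u m n ≤ (Finset.Icc ((t - n + 1) / 2) ((t - m) / 2)).card := by
    refine Finset.card_le_card fun k hk => ?_
    simp only [Finset.mem_image, Finset.mem_filter, Finset.mem_Ico] at hk
    obtain ⟨i, hi, rfl⟩ := hk
    rw [Finset.mem_Icc]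
    omega
  rw [Int.card_Icc] at this
  omega

lemma blocks_le_add {m k n : ℤ} : blocks t u m n ≤ blocks t u m k + blocks t u k n := by
  refine (Finset.card_le_card ?_).trans (Finset.card_union_le _ _)
  rw [← Finset.image_union]
  refine Finset.image_subset_image fun i => ?_
  simp only [Finset.mem_union, Finset.mem_filter, Finset.mem_Ico]
  grind

@[simp] lemma blocks_matchDefects (m n : ℤ) :
    blocks t (matchDefects u) m n = blocks t u m n := by
  simp only [blocks, matchDefects_fwS]

lemma Parity.odd_of_not_dfc (P : Parity a b u c) (hc : c q = true)
    (hn : ∀ i, q < i → i < y → (u i).dfc = false) {i : ℤ} (hqi : q ≤ i) (hiy : i < y) :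
    c i = true := by
  induction i, hqi using Int.leInduction with
  | base => exact hc
  | succ i hi ih => rw [P.step_succ, ih (by omega), hn _ (by omega) hiy]; rfl

lemma Parity.exists_next (P : Parity a b u c) (hc : c q = true) : ∃ y, Next u q y := by
  have hex : ∃ y, q < y ∧ (u y).dfc = true := by
    by_contra! hn
    have := P.odd_of_not_dfc (y := max q b + 1) hc (fun i hi _ => by simpa using hn i hi)
      (le_max_left q b) (by omega)
    simp [P.right _ (le_max_right q b)] at this
  obtain ⟨y, ⟨hqy, hd⟩, hmin⟩ := Int.exists_least_of_bdd ⟨q, fun y hy => hy.1.le⟩ hex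
  exact ⟨y, hqy, hd, fun i hqi hiy =>
    Bool.eq_false_iff.2 fun hdi => absurd (hmin i ⟨hqi, hdi⟩) (by omega)⟩

lemma add_two_le_of_matchDefects_dfc {z : ℤ} (hcor : cor u y = true) (hyz : y ≤ z)
    (hd : (matchDefects u z).dfc = true) : y + 2 ≤ z := by
  rw [matchDefects_dfc] at hd
  have h0 : z ≠ y := by rintro rfl; simp [hcor] at hd
  have h1 : z ≠ y + 1 := by rintro rfl; simp [hcor] at hd
  omega

/- The jump over a matched pair is long enough to pay for the blocks and the debts ahead of it:
the pair itself holds no signal. -/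
lemma Balanced.jump_le {z : ℤ} (B : Balanced u h) (hcor : cor u y = true) (hyz : y + 2 ≤ z)
    (hz : (u z).dfc = true) :
    4 * (blocks t u y z : ℤ) + (∑ i ∈ Finset.Ico y z, debt (u i) : ℕ) + 4 ≤ 4 * (z - y) := by
  have hd := dfc_of_cor hcor
  have hd' := dfc_succ_of_cor hcor
  have hblocks : blocks t u y (y + 2) = 0 := by
    rw [blocks, Finset.card_eq_zero, Finset.image_eq_empty, Finset.filter_eq_empty_iff]
    intro i hi
    rw [Finset.mem_Ico] at hi
    obtain rfl | rfl : i = y ∨ i = y + 1 := by omega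
    exacts [by simp [B.fwS_of_dfc _ hd], by simp [B.fwS_of_dfc _ hd']]
  have := blocks_le_add (t := t) (u := u) (m := y) (k := y + 2) (n := z)
  have := two_mul_blocks_le (t := t) (u := u) hyz
  have hsum : ∑ i ∈ Finset.Ico y z, debt (u i) =
      debt (u y) + (debt (u (y + 1)) + ∑ i ∈ Finset.Ico (y + 2) z, debt (u i)) := by
    rw [← Finset.insert_Ico_add_one_left_eq_Ico (by omega : y < z), Finset.sum_insert (by simp),
      ← Finset.insert_Ico_add_one_left_eq_Ico (by omega : y + 1 < z), Finset.sum_insert (by simp),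
      add_assoc y 1 1, one_add_one_eq_two]
  have hdebt := B.height.sum_debt_le hyz
  have h0 := B.height y
  have h1 := B.height (y + 1)
  rw [B.height_of_dfc z hz, show y + 2 - 1 = y + 1 by ring] at hdebt
  simp only [charge, B.fwS_of_dfc _ hd, B.fwS_of_dfc _ hd', B.bwS_eq_false_of_dfc hd,
    B.bwS_eq_false_of_dfc hd', B.height_of_dfc y hd, add_sub_cancel_right,
    Bool.toNat_false] at h0 h1
  omega

lemma Balanced.debt_le_one_of_dfc_succ (B : Balanced u h) {i : ℤ} (hd : (u i).dfc = true) :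
    debt (u (i - 1)) ≤ 1 := by
  have := B.height (i - 1)
  have := B.nonneg (i - 1 - 1)
  have := Bool.toNat_le (u (i - 1)).fwS
  simp only [charge, B.height_of_dfc i hd, B.bwS_of_dfc i hd, Bool.toNat_false] at *
  omega

lemma load_le (u : Config) (q y : ℤ) :
    load u q y ≤ debt (u q) + ∑ i ∈ Finset.Ico (q + 1) y, debt (u i) := by
  unfold load; split_ifs <;> omega

lemma Next.cor_of_matchDefects (N : Next u q y) (hcor : cor u q = false)
    (hd : (matchDefects u y).dfc = false) : cor u y = true := by
  rw [matchDefects_dfc, N.dfc] at hd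
  by_contra hy
  rw [Bool.not_eq_true] at hy
  have hy' : cor u (y - 1) = true := by simpa [hy] using hd
  have hq : q ≠ y - 1 := by rintro rfl; simp [hcor] at hy'
  have := N.lt
  simpa [N.not_dfc (y - 1) (by omega) (by omega)] using dfc_of_cor hy'

lemma potential_pred_matchDefects_le {z : ℤ} (B : Balanced u h) (hcor : cor u q = true)
    (N : Next (matchDefects u) (q - 1) z) :
    potential t b (matchDefects u) (q - 1) z ≤ 5 * (b - q) := by
  have hz := add_two_le_of_matchDefects_dfc hcor (by have := N.lt; omega) N.dfc
  have := B.jump_le (t := t) hcor hz (dfc_of_matchDefects N.dfc)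
  have := B.debt_le_one_of_dfc_succ (dfc_of_cor hcor)
  have := load_le (matchDefects u) (q - 1) z
  simp only [potential, blocks_matchDefects, debt_matchDefects, sub_add_cancel] at *
  omega

lemma potential_jump_le {z : ℤ} (B : Balanced u h) (hqy : q < y) (hcor : cor u y = true)
    (hyz : y + 2 ≤ z) (hz : (u z).dfc = true) :
    potential t b u q z ≤ potential t b u q y := by
  have := B.jump_le (t := t) hcor hyz hz
  have := blocks_le_add (t := t) (u := u) (m := q + 1) (k := y) (n := z)
  have hsum : ∑ i ∈ Finset.Ico (q + 1) z, debt (u i) =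
      ∑ i ∈ Finset.Ico (q + 1) y, debt (u i) + ∑ i ∈ Finset.Ico y z, debt (u i) := by
    rw [← Finset.sum_union (Finset.Ico_disjoint_Ico_consecutive ..),
      Finset.Ico_union_Ico_eq_Ico (by omega) (by omega)]
  simp only [potential, load, hsum]
  omega

lemma potential_matchDefects (hd : (matchDefects u q).dfc = (u q).dfc) :
    potential t b (matchDefects u) q y = potential t b u q y := by
  simp only [potential, load, blocks_matchDefects, debt_matchDefects, hd]

lemma Behind.matchDefects_dfc_of_odd (F : Behind u c q) (P : Parity a b u c) (hc : c q = true)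
    (hcor : cor u q = false) : (matchDefects u q).dfc = (u q).dfc := by
  rw [matchDefects_dfc, hcor]
  cases hd : (u q).dfc with
  | false => rfl
  | true =>
    have : cor u (q - 1) = false := Bool.eq_false_iff.2 fun hcor' => by
      have := P.step q
      simp [F.odd_of_adjacent (q - 1) (by omega) (dfc_of_cor hcor') (by simpa using hd), hc, hd]
        at this
    simp [this]

lemma Front.exists_next_matchDefects {T : ℤ} (F : Front t b u c q T) (P : Parity a b u c)
    (B : Balanced u h) (C : Confined a b r u h) (hc : c q = true) (hcor : cor u q = false) :
    ∃ y, Next (matchDefects u) q y ∧ potential t b (matchDefects u) q y ≤ T := by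
  obtain ⟨y, N, hT⟩ := F.odd hc
  rw [← potential_matchDefects (F.behind.matchDefects_dfc_of_odd P hc hcor)] at hT
  have hnot : ∀ i, q < i → i < y → (matchDefects u i).dfc = false := fun i hqi hiy => by
    simp [matchDefects_dfc, N.not_dfc i hqi hiy]
  cases hd : (matchDefects u y).dfc with
  | true => exact ⟨y, ⟨N.lt, hd, hnot⟩, hT⟩
  | false =>
    have hcy := N.cor_of_matchDefects hcor hd
    obtain ⟨z, N'⟩ := (P.matchDefects C).exists_next (q := q) (by simp [matchParity, hc, hcor])
    have hyz : y ≤ z := by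
      by_contra! hzy
      simpa [hnot z N'.lt hzy] using N'.dfc
    refine ⟨z, N', le_trans ?_ hT⟩
    rw [potential_matchDefects (F.behind.matchDefects_dfc_of_odd P hc hcor),
      potential_matchDefects (F.behind.matchDefects_dfc_of_odd P hc hcor)]
    exact potential_jump_le B N.lt hcy (add_two_le_of_matchDefects_dfc hcy hyz N'.dfc)
      (dfc_of_matchDefects N'.dfc)

lemma Front.matchDefects_of_even_cor {T : ℤ} (F : Front t b u c q T) (P : Parity a b u c)
    (B : Balanced u h) (C : Confined a b r u h) (hcor : cor u q = true) (hc : c q = false) :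
    Front t b (matchDefects u) (matchParity u c) (q - 1) T := by
  have hq : matchFront u c q = q - 1 := by simp [matchFront, hcor, hc]
  have hcq : matchParity u c (q - 1) = true := by
    have hq0 : (u (q - 1)).dfc = false := by rw [cor] at hcor; grind
    simpa [matchParity, cor, hq0, hc, dfc_of_cor hcor] using P.step q
  refine ⟨hq ▸ F.behind.matchDefects P B, fun hc' => by simp [hcq] at hc', fun _ => ?_⟩
  obtain ⟨z, N⟩ := (P.matchDefects C).exists_next hcq
  exact ⟨z, N, (potential_pred_matchDefects_le B hcor N).trans (F.even hc)⟩

lemma Front.matchDefects_of_odd_cor {T : ℤ} (F : Front t b u c q T) (P : Parity a b u c)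
    (B : Balanced u h) (hcor : cor u q = true) (hc : c q = true) :
    Front t b (matchDefects u) (matchParity u c) (q + 1) T := by
  have hq : matchFront u c q = q + 1 := by simp [matchFront, hcor, hc]
  have hcq : matchParity u c (q + 1) = false := by
    simp [matchParity, cor_succ_of_dfc (dfc_of_cor hcor), P.step_succ, hc, dfc_succ_of_cor hcor]
  refine ⟨hq ▸ F.behind.matchDefects P B, fun _ => ?_, fun hc' => by simp [hcq] at hc'⟩
  obtain ⟨y, N, hT⟩ := F.odd hc
  have hy : y ≤ q + 1 := by
    by_contra! hy
    simpa [N.not_dfc _ (by omega) hy] using dfc_succ_of_cor hcor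
  simp only [potential] at hT
  omega

protected lemma Front.matchDefects {T : ℤ} (F : Front t b u c q T) (P : Parity a b u c)
    (B : Balanced u h) (C : Confined a b r u h) :
    Front t b (matchDefects u) (matchParity u c) (matchFront u c q) T := by
  cases hcor : cor u q with
  | false =>
    have hq : matchFront u c q = q := by simp [matchFront, hcor]
    have hcq : matchParity u c q = c q := by simp [matchParity, hcor]
    have F' := F.behind.matchDefects P B
    rw [hq] at F' ⊢
    exact ⟨F', fun hc => F.even (hcq ▸ hc), fun hc =>
      F.exists_next_matchDefects P B C (hcq ▸ hc) hcor⟩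
  | true =>
    cases hc : c q with
    | false => simpa [matchFront, hcor, hc] using F.matchDefects_of_even_cor P B C hcor hc
    | true => simpa [matchFront, hcor, hc] using F.matchDefects_of_odd_cor P B hcor hc

end Potential

section Propagate
variable {a b r t q y : ℤ} {u : Config} {h : ℤ → ℤ} {c : ℤ → Bool}

/- A signal that moves to the right and does not enter at `m` cannot be counted twice. -/
lemma sum_toNat_le_of_shift {f g : ℤ → Bool} {m : ℤ} (hm : g m = false)
    (hab : ∀ i, g i = true → f (i - 1) = true) (n : ℤ) :
    ∑ i ∈ Finset.Ico m n, (g i).toNat ≤ ∑ i ∈ Finset.Ico m n, (f i).toNat := by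
  have hcard : ∀ f : ℤ → Bool, ∑ i ∈ Finset.Ico m n, (f i).toNat =
      ((Finset.Ico m n).filter fun i => f i = true).card := fun f => by
    rw [Finset.card_filter]
    exact Finset.sum_congr rfl fun i _ => by cases f i <;> rfl
  rw [hcard, hcard]
  refine Finset.card_le_card_of_injOn (· - 1) (fun i hi => ?_) (sub_left_injective.injOn)
  simp only [Finset.coe_filter, Finset.mem_Ico, Set.mem_ofPred_eq] at hi ⊢
  have : i ≠ m := by rintro rfl; simp [hm] at hi
  exact ⟨by omega, hab i hi.2⟩

lemma anti_anS_pred_of_succ {k : ℕ} {i : ℤ} (ha : (anti u (k + 1) i).anS = true) :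
    (anti u k (i - 1)).anS = true := by
  rw [anti_succ, antiStep_anS] at ha; grind

lemma sum_debt_propagate_le {m n : ℤ} (h1 : (anti u 1 m).anS = false)
    (h2 : (anti u 2 m).anS = false) (h3 : (propagate u m).anS = false)
    (hd : ∀ i, m ≤ i → i < n → (u i).dfc = false) :
    ∑ i ∈ Finset.Ico m n, debt (propagate u i) ≤ ∑ i ∈ Finset.Ico m n, debt (u i) := by
  have e1 := sum_toNat_le_of_shift (f := fun i => (anti u 0 i).anS)
    (g := fun i => (anti u 1 i).anS) h1 (fun _ => anti_anS_pred_of_succ) n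
  have e2 := sum_toNat_le_of_shift (f := fun i => (anti u 1 i).anS)
    (g := fun i => (anti u 2 i).anS) h2 (fun _ => anti_anS_pred_of_succ) n
  have e3 := sum_toNat_le_of_shift (f := fun i => (anti u 2 i).anS)
    (g := fun i => (propagate u i).anS) h3 (fun _ => anti_anS_of_propagate) n
  calc ∑ i ∈ Finset.Ico m n, debt (propagate u i)
      ≤ ∑ i ∈ Finset.Ico m n, debt (emitted u i) := by
        simp only [debt, Finset.sum_add_distrib, propagate_sta]
        exact Nat.add_le_add_left (e3.trans (e2.trans e1)) _
    _ ≤ ∑ i ∈ Finset.Ico m n, debt (u i) := Finset.sum_le_sum fun i hi => by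
        rw [Finset.mem_Ico] at hi
        exact debt_emitted_le_of_not_dfc (hd i hi.1 hi.2)

lemma fwS_pred_of_propagate {i : ℤ} (hd : (u (i - 1)).dfc = false)
    (hf : (propagate u i).fwS = true) : (u (i - 1)).fwS = true := by
  by_contra hu
  simp [propagate_fwS_of_dfc hd (by simpa using hu)] at hf

lemma blocks_propagate_le {m : ℤ} (hd : ∀ i, q < i → i < y → (u i).dfc = false)
    (hf : ∀ i, m ≤ i → (propagate u i).fwS = true → q + 2 ≤ i) :
    blocks (t + 1) (propagate u) m y ≤ blocks t u (q + 1) y := by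
  refine Finset.card_le_card fun k hk => ?_
  simp only [Finset.mem_image, Finset.mem_filter, Finset.mem_Ico] at hk ⊢
  obtain ⟨i, ⟨hi, hfi⟩, rfl⟩ := hk
  have := hf i hi.1 hfi
  exact ⟨i - 1, ⟨by omega, fwS_pred_of_propagate (hd _ (by omega) (by omega)) hfi⟩, by ring_nf⟩

/- The block of the signal that hits `y` is used up. -/
lemma blocks_propagate_lt {m : ℤ} (hqy : q + 2 ≤ y)
    (hd : ∀ i, q < i → i < y → (u i).dfc = false)
    (hf : ∀ i, m ≤ i → (propagate u i).fwS = true → q + 2 ≤ i) (hy : (u (y - 1)).fwS = true) :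
    blocks (t + 1) (propagate u) m (y - 1) < blocks t u (q + 1) y := by
  refine Finset.card_lt_card (Finset.ssubset_iff.2 ⟨(t - (y - 1)) / 2, ?_, fun k hk => ?_⟩)
  · simp only [Finset.mem_image, Finset.mem_filter, Finset.mem_Ico]
    rintro ⟨i, hi, h1⟩
    omega
  simp only [Finset.mem_insert, Finset.mem_image, Finset.mem_filter, Finset.mem_Ico] at hk ⊢
  rcases hk with rfl | ⟨i, ⟨hi, hfi⟩, rfl⟩
  · exact ⟨y - 1, ⟨by omega, hy⟩, rfl⟩
  have := hf i hi.1 hfi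
  exact ⟨i - 1, ⟨by omega, fwS_pred_of_propagate (hd _ (by omega) (by omega)) hfi⟩, by ring_nf⟩

lemma Next.not_dfc_propagate (N : Next u q y) {i : ℤ} (hqi : q < i) (hiy : i < y)
    (hh : hits u (i + 1) = false) : (propagate u i).dfc = false := by
  simp [reflected_dfc, hh, N.not_dfc i hqi hiy]

lemma Next.not_hits (N : Next u q y) {i : ℤ} (hqi : q < i) (hiy : i < y) : hits u i = false := by
  simp [hits, N.not_dfc i hqi hiy]

lemma Next.propagate_of_hits (N : Next u q y) {p : ℤ} (hqp : q ≤ p) (hpy : p + 1 < y)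
    (hh : hits u y = true) : Next (propagate u) p (y - 1) where
  lt := by omega
  dfc := by simp [reflected_dfc, hh]
  not_dfc i hi hiy :=
    N.not_dfc_propagate (by omega) (by omega) (N.not_hits (by omega) (by omega))

lemma Next.propagate_of_not_hits (N : Next u q y) {p : ℤ} (hqp : q ≤ p)
    (hpy : p < y) (hh : hits u y = false) : Next (propagate u) p y where
  lt := hpy
  dfc := by simp [reflected_dfc, N.dfc, hh]
  not_dfc i hi hiy := by
    refine N.not_dfc_propagate (by omega) hiy ?_
    rcases (show i + 1 ≤ y by omega).lt_or_eq with hi' | rfl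
    exacts [N.not_hits (by omega) hi', hh]

protected lemma Next.propagate (N : Next u q y) (hd : (u (q + 1)).dfc = false)
    (hh : hits u (q + 1 + 1) = false) {p : ℤ} (hqp : q ≤ p) (hpq : p ≤ q + 1)
    (hf : ∀ i, p + 1 ≤ i → (propagate u i).fwS = true → q + 2 ≤ i) :
    ∃ z, Next (propagate u) p z ∧ z ≤ y ∧
      4 * (b - z) + 4 * (blocks (t + 1) (propagate u) (p + 1) z : ℤ) ≤
        4 * (b - y) + 4 * blocks t u (q + 1) y := by
  have hlt := N.lt
  have hy : y ≠ q + 1 := by rintro rfl; simp [N.dfc] at hd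
  cases hhy : hits u y with
  | true =>
    have hy' : y ≠ q + 1 + 1 := by rintro rfl; simp [hhy] at hh
    have := blocks_propagate_lt (t := t) (by omega) N.not_dfc hf (fwS_of_hits hhy)
    exact ⟨y - 1, N.propagate_of_hits hqp (by omega) hhy, by omega, by omega⟩
  | false =>
    have := blocks_propagate_le (t := t) N.not_dfc hf
    exact ⟨y, N.propagate_of_not_hits hqp (by omega) hhy, le_rfl, by omega⟩

lemma Behind.reflected_fwS_succ (F : Behind u c q) (hc : c q = true)
    (hd : (u (q + 1)).dfc = false) (hh : hits u (q + 1 + 1) = false) :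
    (reflected u (q + 1)).fwS = true := by
  have hh' : hits u (q + 1) = false := by simp [hits, hd]
  simp [reflected_fwS, F.sendForward_fwS_of_odd le_rfl hc hd, hh, hh']

lemma Behind.sum_debt_propagate_le (F : Behind u c q) (P : Parity a b u c) (B : Balanced u h)
    (hc : c q = true) (hd : (u (q + 1)).dfc = false) (hh : hits u (q + 1 + 1) = false)
    (N : Next u q y) {z : ℤ} (hzy : z ≤ y) :
    ∑ i ∈ Finset.Ico (q + 1) z, debt (propagate u i) ≤
      ∑ i ∈ Finset.Ico (q + 1) y, debt (u i) := by
  have p0 : propagateParity u c q = true :=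
    (propagateParity_of_not_hits (by simp [hits, hd])).trans hc
  have ha : ∀ k, (anti u (k + 1) q).anS = false := fun k =>
    Bool.eq_false_iff.2 fun ha => absurd (anti_anS_pred_of_succ ha)
      (by simp [F.anti_anS_pred P B le_rfl p0 k])
  refine (ASR.sum_debt_propagate_le ?_ ?_ ?_
    fun i hi hiz => N.not_dfc i (by omega) (by omega)).trans
    (Finset.sum_le_sum_of_subset (Finset.Ico_subset_Ico le_rfl hzy))
  · have := F.reflected_fwS_succ hc hd hh
    simp [antiStep_anS, anti, this]
  · simp [anti_succ u 1, antiStep_anS, ha 0]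
  · simp [propagate, antiLastStep_anS, ha 1]

end Propagate

namespace Front
variable {a b r t q y T : ℤ} {u : Config} {h : ℤ → ℤ} {c : ℤ → Bool}

lemma propagate_of_even (F : Front t b u c q T) (P : Parity a b u c) (B : Balanced u h)
    (C : Confined a b r u h) (S : Separated u q) (hc : c q = false) :
    Front (t + 1) b (propagate u) (propagateParity u c) (q + 1) (T - 1) := by
  have hT := F.even hc
  refine ⟨F.behind.propagate_succ_of_even P B C S hc, fun _ => by omega, fun hc' => ?_⟩
  obtain ⟨y, N⟩ := (P.propagate B C).exists_next hc'
  have hd : (propagate u (q + 1)).dfc = true := by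
    have := (P.propagate B C).step_succ q
    rw [hc', F.behind.propagateParity_of_even hc] at this
    simpa using this.symm
  have hlt := N.lt
  have := two_mul_blocks_le (t := t + 1) (u := propagate u) (m := q + 1 + 1) (n := y) (by omega)
  have := B.propagate.height.sum_debt_le (m := q + 1 + 1) (n := y) (by omega)
  have := B.propagate.nonneg (q + 1 + 1 - 1)
  have := B.propagate.height_of_dfc y N.dfc
  refine ⟨y, N, ?_⟩
  rw [potential, load, hd, if_pos rfl]
  omega

lemma propagate_of_debt_eq_zero (F : Front t b u c q T) (P : Parity a b u c)
    (B : Balanced u h) (S : Separated u q) (hc : c q = true) (hd : (u (q + 1)).dfc = false)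
    (hh : hits u (q + 1 + 1) = false)
    (hs : (reflected u q).dfc = false → debt (backward u 3 q) = 0) :
    Front (t + 1) b (propagate u) (propagateParity u c) (q + 1) (T - 1) := by
  have p1 : propagateParity u c (q + 1) = true := by
    rw [propagateParity_of_not_hits hh, P.step_succ q, hc, hd]
    rfl
  refine ⟨F.behind.propagate_succ_of_debt P B S hc hd hh hs, fun hc' => by simp [p1] at hc',
    fun _ => ?_⟩
  obtain ⟨y, N, hT⟩ := F.odd hc
  obtain ⟨z, N', hzy, hz⟩ := N.propagate (b := b) (t := t) (p := q + 1) hd hh (by omega) le_rfl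
    (fun i hi _ => by omega)
  have hsum := F.behind.sum_debt_propagate_le P B hc hd hh N hzy
  rw [← Finset.insert_Ico_add_one_left_eq_Ico N'.lt, Finset.sum_insert (by simp)] at hsum
  have := load_le (propagate u) (q + 1) z
  refine ⟨z, N', ?_⟩
  unfold potential at *
  have : load (propagate u) (q + 1) z ≤ load u q y := by
    rw [load.eq_1 u]
    omega
  omega

lemma propagate_of_debt_ne_zero (F : Front t b u c q T) (P : Parity a b u c)
    (B : Balanced u h) (S : Separated u q) (hc : c q = true) (hd : (u (q + 1)).dfc = false)
    (hh : hits u (q + 1 + 1) = false) (hdq : (reflected u q).dfc = false)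
    (hs : debt (backward u 3 q) ≠ 0) :
    Front (t + 1) b (propagate u) (propagateParity u c) q (T - 1) := by
  have p0 : propagateParity u c q = true :=
    (propagateParity_of_not_hits (by simp [hits, hd])).trans hc
  refine ⟨F.behind.propagate P B S, fun hc' => by simp [p0] at hc', fun _ => ?_⟩
  obtain ⟨y, N, hT⟩ := F.odd hc
  have ha : (emitted u q).anS = true := emitted_anS_of_not_dfc hdq hs
  have hf : (propagate u (q + 1)).fwS = false := by simp [propagate_fwS, anti, ha]
  obtain ⟨z, N', hzy, hz⟩ := N.propagate (b := b) (t := t) (p := q) hd hh le_rfl (by omega)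
    (fun i hi hfi => by
      have : i ≠ q + 1 := by rintro rfl; simp [hf] at hfi
      omega)
  refine ⟨z, N', ?_⟩
  have hdq0 := F.behind.dfc_of_propagateParity P le_rfl p0 hdq
  have hsum := F.behind.sum_debt_propagate_le P B hc hd hh N hzy
  have hlt : debt (propagate u q) + 1 ≤ debt (u q) := by
    refine le_trans (le_of_eq ?_) (debt_emitted_le_of_not_dfc hdq0)
    simp [debt, propagate_sta, F.behind.propagate_anS P B le_rfl p0, ha]
  have : load (propagate u) q z + 1 ≤ load u q y := by
    simp only [load, propagate_dfc, hdq, hdq0, Bool.false_eq_true, if_false]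
    omega
  unfold potential at *
  omega

lemma propagate_of_odd (F : Front t b u c q T) (P : Parity a b u c) (B : Balanced u h)
    (S : Separated u q) (hc : c q = true) :
    ∃ p, Front (t + 1) b (propagate u) (propagateParity u c) p (T - 1) := by
  obtain ⟨y, N, hT⟩ := F.odd hc
  unfold potential at hT
  cases hd : (u (q + 1)).dfc with
  | true =>
    have p1 := Behind.propagateParity_of_contact P B hc hd
    have hy : y ≤ q + 1 := by
      by_contra! hy
      simp [N.not_dfc _ (by omega) hy] at hd
    exact ⟨q + 1, F.behind.propagate_succ_of_contact P B S hc hd, fun _ => by omega,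
      fun hc' => by simp [p1] at hc'⟩
  | false =>
    cases hh : hits u (q + 1 + 1) with
    | true =>
      have p2 := Behind.propagateParity_of_contact_two P B hc hh
      have hy : y ≤ q + 1 + 1 := by
        by_contra! hy
        simpa [N.not_dfc _ (by omega) hy] using dfc_of_hits hh
      exact ⟨q + 1 + 1, F.behind.propagate_succ_of_contact_two P B S hc hh, fun _ => by omega,
        fun hc' => by simp [p2] at hc'⟩
    | false =>
      by_cases hs : (reflected u q).dfc = false → debt (backward u 3 q) = 0
      · exact ⟨q + 1, F.propagate_of_debt_eq_zero P B S hc hd hh hs⟩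
      · push Not at hs
        exact ⟨q, F.propagate_of_debt_ne_zero P B S hc hd hh hs.1 hs.2⟩

protected lemma propagate (F : Front t b u c q T) (P : Parity a b u c) (B : Balanced u h)
    (C : Confined a b r u h) (S : Separated u q) :
    ∃ p, Front (t + 1) b (propagate u) (propagateParity u c) p (T - 1) := by
  cases hc : c q with
  | true => exact F.propagate_of_odd P B S hc
  | false => exact ⟨q + 1, F.propagate_of_even P B C S hc⟩

end Front

/-- The parity of the defects after an iteration. -/
def nextParity (u : Config) (c : ℤ → Bool) : ℤ → Bool :=
  propagateParity (matchDefects u) (matchParity u c)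

/-- The number of sites of odd parity. -/
noncomputable def oddCount (a b : ℤ) (c : ℤ → Bool) : ℕ :=
  ((Finset.Ico a b).filter fun i => c i = true).card

section
variable {a b r t q i y T : ℤ} {u : Config} {h : ℤ → ℤ} {c : ℤ → Bool}

lemma oddCount_le (hab : a ≤ b) (c : ℤ → Bool) : (oddCount a b c : ℤ) ≤ b - a := by
  have := Finset.card_filter_le (Finset.Ico a b) fun i => c i = true
  rw [Int.card_Ico] at this
  unfold oddCount
  omega

lemma Parity.mem_Ico (P : Parity a b u c) (hc : c i = true) : i ∈ Finset.Ico a b := by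
  rw [Finset.mem_Ico]
  constructor <;> by_contra! hi
  · simp [P.left i hi] at hc
  · simp [P.right i hi] at hc

lemma Parity.eq_false_of_oddCount (P : Parity a b u c) (h0 : oddCount a b c = 0) (i : ℤ) :
    c i = false :=
  Bool.eq_false_iff.2 fun hc =>
    Finset.filter_eq_empty_iff.1 (Finset.card_eq_zero.1 h0) (P.mem_Ico hc) hc

lemma Front.le_of_nonpos (F : Front t b u c q T) (C : Confined a b r u h) (hT : T ≤ 0) :
    b ≤ q := by
  cases hc : c q with
  | false =>
    have := F.even hc
    omega
  | true =>
    obtain ⟨y, N, hy⟩ := F.odd hc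
    have := N.lt
    have := C.dfc_le y N.dfc
    unfold potential at hy
    omega

lemma Confined.matchFront_eq (C : Confined a b r u h) (c : ℤ → Bool) (hq : b ≤ q) :
    matchFront u c q = q := by
  rw [matchFront, if_neg]
  intro hcor
  have := C.dfc_le _ (dfc_succ_of_cor hcor)
  omega

namespace Behind

lemma odd_of_matchParity_of_le (F : Behind u c q) (P : Parity a b u c)
    (C : Confined a b r u h) (hq : b ≤ q) (hc : matchParity u c i = true) : c i = true := by
  have := Finset.mem_Ico.1 ((P.matchDefects C).mem_Ico hc)
  exact F.odd_of_matchParity (by rw [C.matchFront_eq c hq]; omega) hc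

lemma matchParity_of_nextParity (F : Behind u c q) (P : Parity a b u c) (B : Balanced u h)
    (C : Confined a b r u h) (hq : b ≤ q) (hc : nextParity u c i = true) :
    matchParity u c i = true := by
  have := Finset.mem_Ico.1 (((P.matchDefects C).propagate B.matchDefects C.matchDefects).mem_Ico hc)
  by_contra hm
  have hm := Bool.eq_false_iff.2 hm
  have hh := (F.matchDefects P B).hits_of_even (by rw [C.matchFront_eq c hq]; omega) hm
  rw [nextParity, propagateParity_of_not_hits hh, hm] at hc
  exact Bool.false_ne_true hc

/- If the pair `y - 1`, `y` is not matched, the forward-signal at `y - 1` hits the defect `y`. -/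
lemma nextParity_pred (F : Behind u c q) (P : Parity a b u c) (B : Balanced u h)
    (C : Confined a b r u h) (hq : b ≤ q) (hd : (u y).dfc = true) (hc : c (y - 1) = true) :
    nextParity u c (y - 1) = false := by
  have hy := C.dfc_le y hd
  have hm := C.matchFront_eq c hq
  refine Bool.eq_false_iff.2 fun hn => ?_
  have hc' := F.matchParity_of_nextParity P B C hq hn
  have hcor : cor u y = false := Bool.eq_false_iff.2 fun hcor => by
    have := P.step y
    rw [hc, hd, F.odd_of_cor (by omega) hcor] at this
    exact Bool.noConfusion this
  have hcor' := F.cor_of_matchParity (i := y - 1) (by omega) hc'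
  have hd' : (matchDefects u (y - 1 + 1)).dfc = true := by
    simp [matchDefects_dfc, hd, hcor, hcor']
  have hh := (F.matchDefects P B).hits_of_odd (F.matchDefects_separated P) (by omega) hc' hd'
  rw [nextParity, propagateParity_of_hits hh hc'] at hn
  exact Bool.false_ne_true hn

lemma oddCount_nextParity_lt (F : Behind u c q) (P : Parity a b u c) (B : Balanced u h)
    (C : Confined a b r u h) (hq : b ≤ q) (hc : c i = true) :
    oddCount a b (nextParity u c) < oddCount a b c := by
  obtain ⟨y, N⟩ := P.exists_next hc
  have hy : c (y - 1) = true :=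
    P.odd_of_not_dfc hc N.not_dfc (by have := N.lt; omega) (by omega)
  refine Finset.card_lt_card (Finset.ssubset_iff.2 ⟨y - 1, ?_, fun j hj => ?_⟩)
  · simp [F.nextParity_pred P B C hq N.dfc hy]
  · simp only [Finset.mem_insert, Finset.mem_filter] at hj ⊢
    rcases hj with rfl | ⟨hj, hcj⟩
    · exact ⟨P.mem_Ico hy, hy⟩
    · exact ⟨hj, F.odd_of_matchParity_of_le P C hq (F.matchParity_of_nextParity P B C hq hcj)⟩

end Behind

/-- The state at time `t` of an evolution with defects in `[a, b]`: after the remaining time `T`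
the front has passed all the defects, and then the number of sites of odd parity decreases with
every iteration. -/
structure Stage (a b t T : ℤ) (u : Config) (h : ℤ → ℤ) (c : ℤ → Bool) (q : ℤ) : Prop where
  balanced : Balanced u h
  confined : Confined a b (b + t) u h
  parity : Parity a b u c
  front : Front t b u c q T
  oddCount_le : T ≤ 0 → (oddCount a b c : ℤ) ≤ max 0 (b - a + T)

namespace Stage

lemma not_dfc (A : Stage a b t T u h c q) (hab : a ≤ b) (hT : b - a + T ≤ 0) (i : ℤ) :
    (u i).dfc = false := by
  have hc := A.parity.eq_false_of_oddCount (by have := A.oddCount_le (by omega); omega)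
  have := A.parity.step i
  simpa [hc] using this.symm

lemma oddCount_nextParity_le (A : Stage a b t T u h c q) (hab : a ≤ b) (hT : T - 1 ≤ 0) :
    (oddCount a b (nextParity u c) : ℤ) ≤ max 0 (b - a + (T - 1)) := by
  rcases (show T = 1 ∨ T ≤ 0 by omega) with rfl | hT
  · have := ASR.oddCount_le hab (nextParity u c)
    omega
  have hq := A.front.le_of_nonpos A.confined hT
  have := A.oddCount_le hT
  by_cases hc : ∃ i, c i = true
  · obtain ⟨i, hi⟩ := hc
    have := A.front.behind.oddCount_nextParity_lt A.parity A.balanced A.confined hq hi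
    omega
  · push Not at hc
    have h0 : oddCount a b (nextParity u c) = 0 := by
      refine Finset.card_eq_zero.2 (Finset.filter_eq_empty_iff.2 fun i _ hi => hc i ?_)
      exact A.front.behind.odd_of_matchParity_of_le A.parity A.confined hq
        (A.front.behind.matchParity_of_nextParity A.parity A.balanced A.confined hq hi)
    omega

protected lemma iteration (A : Stage a b t T u h c q) (hab : a ≤ b) :
    ∃ h' c' q', Stage a b (t + 1) (T - 1) (iteration 3 3 u) h' c' q' := by
  have B := A.balanced.matchDefects
  have C := A.confined.matchDefects
  have P := A.parity.matchDefects A.confined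
  obtain ⟨p, F⟩ := (A.front.matchDefects A.parity A.balanced A.confined).propagate P B C
    (A.front.behind.matchDefects_separated A.parity)
  exact ⟨_, _, p, B.propagate, by rw [← add_assoc]; exact C.propagate B, P.propagate B C, F,
    A.oddCount_nextParity_le hab⟩

lemma iterate (A : Stage a b t T u h c q) (hab : a ≤ b) (n : ℕ) :
    ∃ h' c' q', Stage a b (t + n) (T - n) ((iteration 3 3)^[n] u) h' c' q' := by
  induction n with
  | zero => exact ⟨h, c, q, by simpa using A⟩
  | succ n ih =>
    obtain ⟨_, _, _, A'⟩ := ih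
    rw [Function.iterate_succ_apply', Nat.cast_succ, ← add_assoc, ← sub_sub]
    exact A'.iteration hab

end Stage
end

section Erasure
variable {a b r L R i : ℤ} {u : Config} {h : ℤ → ℤ}

lemma iteration_eq_propagate (hd : ∀ i, (u i).dfc = false) : iteration 3 3 u = propagate u := by
  have : matchDefects u = u := by
    funext i
    ext1 <;> simp [matchDefects_dfc, hd]
  rw [iteration_eq, this]

lemma propagate_sta_le (hd : (u i).dfc = false) : (propagate u i).sta ≤ (u i).sta := by
  rw [propagate_sta, ← sendForward_sta_of_not_dfc hd]
  exact emitted_sta_le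

lemma propagate_sta_lt (hd : ∀ i, (u i).dfc = false) (hs : 0 < (u i).sta)
    (ha : (u i).anS = false) : (propagate u i).sta < (u i).sta := by
  have hd' : (reflected u i).dfc = false := by simp [reflected_dfc, hits, hd]
  have ha' : (backward u 3 i).anS = false := by
    refine Bool.eq_false_of_le_false ((antitone_backward_anS u i (Nat.zero_le 3)).trans_eq ?_)
    simp [backward, ha]
  have : (backward u 3 i).sta ≤ (u i).sta := by
    simpa [backward, sendForward_sta_of_not_dfc (hd i)] using
      antitone_backward_sta u i (Nat.zero_le 3)
  rw [propagate_sta, emitted, sendAnti_sta, backward_dfc, hd', ha']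
  simp only [Bool.not_false, Bool.and_self, if_true]
  omega

lemma propagate_anS_of_debt (hd : ∀ i, (u i).dfc = false) (h0 : debt (u (i - 3)) = 0) :
    (propagate u i).anS = false :=
  Bool.eq_false_iff.2 fun ha => by
    have he := emitted_anS_of_anti (anti_anS_of_propagate ha)
    have := debt_emitted_le_of_not_dfc (hd (i - 3))
    rw [h0, Nat.le_zero, debt_eq_zero] at this
    rw [show i - 1 - (2 : ℕ) = i - 3 by push_cast; ring, this.2] at he
    exact Bool.false_ne_true he

/-- There are no debts on the left of `L`, and no anti-signal at `L`. -/
structure Swept (u : Config) (L : ℤ) : Prop where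
  sta : ∀ i < L, (u i).sta = 0
  anS : ∀ i ≤ L, (u i).anS = false

/-- The total of the stacks. -/
noncomputable def stackSum (a b : ℤ) (u : Config) : ℕ := ∑ i ∈ Finset.Icc a b, (u i).sta

/-- The invariants of a configuration without defects. -/
structure Calm (a b r : ℤ) (u : Config) (h : ℤ → ℤ) : Prop where
  balanced : Balanced u h
  confined : Confined a b r u h
  not_dfc : ∀ i, (u i).dfc = false

lemma Swept.propagate_anS (W : Swept u L) (hd : ∀ i, (u i).dfc = false) (hi : i ≤ L + 1) :
    (propagate u i).anS = false :=
  propagate_anS_of_debt hd (debt_eq_zero.2 ⟨W.sta _ (by omega), W.anS _ (by omega)⟩)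

/- In each iteration either the stack at `L` emits an anti-signal or `L` moves on. -/
protected lemma Swept.propagate (W : Swept u L) (C : Confined a b r u h)
    (hd : ∀ i, (u i).dfc = false) :
    ∃ L', Swept (propagate u) L' ∧
      (stackSum a b (propagate u) : ℤ) - L' + 1 ≤ stackSum a b u - L := by
  have hs : ∀ i, (u i).sta = 0 → (propagate u i).sta = 0 := fun i hi =>
    Nat.le_zero.1 (hi ▸ propagate_sta_le (hd i))
  by_cases hL : (u L).sta = 0
  · have : stackSum a b (propagate u) ≤ stackSum a b u :=
      Finset.sum_le_sum fun i _ => propagate_sta_le (hd i)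
    refine ⟨L + 1, ⟨fun i hi => hs i ?_, fun i => W.propagate_anS hd⟩, by omega⟩
    rcases (show i ≤ L by omega).lt_or_eq with hi | rfl
    exacts [W.sta i hi, hL]
  · have ha : a ≤ L := by
      by_contra! ha
      simp [C.left L ha, Site.zero] at hL
    have : stackSum a b (propagate u) < stackSum a b u :=
      Finset.sum_lt_sum (fun i _ => propagate_sta_le (hd i))
        ⟨L, Finset.mem_Icc.2 ⟨ha, C.sta_le L (by omega)⟩,
          propagate_sta_lt hd (by omega) (W.anS L le_rfl)⟩
    exact ⟨L, ⟨fun i hi => hs i (W.sta i hi), fun i hi => W.propagate_anS hd (by omega)⟩,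
      by omega⟩

lemma Confined.swept (C : Confined a b r u h) : Swept u (a - 1) where
  sta i hi := by rw [C.left i (by omega)]; rfl
  anS i hi := by rw [C.left i (by omega)]; rfl

lemma Confined.eq_zero_of_lt (B : Balanced u h) (C : Confined a b r u h) (hi : r < i) :
    u i = Site.zero := by
  have hr := C.le
  have hh := B.height i
  rw [C.height_right i hi.le, C.height_right (i - 1) (by omega)] at hh
  have hd : (u i).dfc = false := Bool.eq_false_iff.2 fun hx => by
    have := C.dfc_le i hx
    omega
  have hf : (u i).fwS = false := Bool.eq_false_iff.2 fun hx => by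
    have := C.fwS_le i hx
    omega
  have hb : (u i).bwS = false := Bool.eq_false_iff.2 fun hx => by
    have := C.bwS_le i hx
    omega
  have h0 : debt (u i) = 0 := by simpa [charge, hf, hb] using hh.symm
  exact Site.ext hd hf hb (debt_eq_zero.1 h0).2 (debt_eq_zero.1 h0).1

lemma Confined.height_eq_zero (B : Balanced u h) (C : Confined a b r u h)
    (h0 : ∀ i, debt (u i) = 0) (i : ℤ) : h i = 0 := by
  rcases lt_or_ge i (a - 1) with hi | hi
  · exact C.height_left i (by omega)
  induction i, hi using Int.leInduction with
  | base => exact C.height_left _ (by omega)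
  | succ i _ ih =>
    have hh := B.height (i + 1)
    have := B.nonneg (i + 1)
    simp only [add_sub_cancel_right, charge, h0] at hh
    omega

namespace Calm

lemma stackSum_le (A : Calm a b r u h) (hab : a ≤ b) :
    (stackSum a b u : ℤ) ≤ 2 * (r + 1 - a) := by
  have hr := A.confined.le
  have hsum := A.balanced.height.sum_debt_le (m := a) (n := r + 1) (by omega)
  rw [add_sub_cancel_right, A.confined.height_right r le_rfl] at hsum
  have := A.balanced.nonneg (a - 1)
  have : stackSum a b u ≤ ∑ i ∈ Finset.Ico a (r + 1), debt (u i) :=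
    (Finset.sum_le_sum fun i _ => Nat.le_add_right _ _).trans
      (Finset.sum_le_sum_of_subset fun i => by simp only [Finset.mem_Icc, Finset.mem_Ico]; omega)
  omega

lemma eq_zero (A : Calm a b r u h) (h0 : ∀ i, debt (u i) = 0) (i : ℤ) : u i = Site.zero := by
  have hh := A.balanced.height i
  have hz := A.confined.height_eq_zero A.balanced h0
  simp only [hz, charge, h0] at hh
  refine Site.ext (A.not_dfc i) ?_ ?_ (debt_eq_zero.1 (h0 i)).2 (debt_eq_zero.1 (h0 i)).1
  · exact Bool.eq_false_iff.2 fun hf => by simp [hf] at hh; omega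
  · exact Bool.eq_false_iff.2 fun hb => by simp [hb] at hh; omega

protected lemma iteration (A : Calm a b r u h) :
    Calm a b (r + 1) (iteration 3 3 u) (antiHeight h u 3) := by
  rw [iteration_eq_propagate A.not_dfc]
  exact ⟨A.balanced.propagate, A.confined.propagate A.balanced,
    fun i => by simp [reflected_dfc, hits, A.not_dfc]⟩

lemma iterate (A : Calm a b r u h) (n : ℕ) :
    ∃ h', Calm a b (r + n) ((iteration 3 3)^[n] u) h' := by
  induction n with
  | zero => exact ⟨h, by simpa using A⟩
  | succ n ih =>
    obtain ⟨h', A'⟩ := ih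
    rw [Function.iterate_succ_apply', Nat.cast_succ, ← add_assoc]
    exact ⟨_, A'.iteration⟩

lemma exists_swept_iterate (A : Calm a b r u h) (W : Swept u L) (n : ℕ) :
    ∃ L', Swept ((iteration 3 3)^[n] u) L' ∧
      (stackSum a b ((iteration 3 3)^[n] u) : ℤ) - L' + n ≤ stackSum a b u - L := by
  induction n with
  | zero => exact ⟨L, W, by simp⟩
  | succ n ih =>
    obtain ⟨L', W', hL'⟩ := ih
    obtain ⟨h', A'⟩ := A.iterate n
    obtain ⟨L'', W'', hL''⟩ := W'.propagate A'.confined A'.not_dfc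
    rw [Function.iterate_succ_apply', iteration_eq_propagate A'.not_dfc]
    exact ⟨L'', W'', by push_cast; omega⟩

lemma debt_iterate (A : Calm a b r u h) (hs : ∀ i, (u i).sta = 0)
    (ha : ∀ i ≤ R, (u i).anS = false) (n : ℕ) :
    (∀ i, ((iteration 3 3)^[n] u i).sta = 0) ∧
      ∀ i ≤ R + 3 * n, ((iteration 3 3)^[n] u i).anS = false := by
  induction n with
  | zero => exact ⟨hs, by simpa using ha⟩
  | succ n ih =>
    obtain ⟨h', A'⟩ := A.iterate n
    rw [Function.iterate_succ_apply', iteration_eq_propagate A'.not_dfc]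
    refine ⟨fun i => Nat.le_zero.1 (ih.1 i ▸ propagate_sta_le (A'.not_dfc i)), fun i hi => ?_⟩
    push_cast at hi
    exact propagate_anS_of_debt A'.not_dfc (debt_eq_zero.2 ⟨ih.1 _, ih.2 _ (by omega)⟩)

/- At speed `3` the anti-signals overtake the edge `r` of the support, which has speed `1`. -/
lemma iterate_eq_zero_of_sta (A : Calm a b r u h) (hs : ∀ i, (u i).sta = 0)
    (ha : ∀ i ≤ R, (u i).anS = false) {n : ℕ} (hn : r - R ≤ 2 * n) (i : ℤ) :
    (iteration 3 3)^[n] u i = Site.zero := by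
  obtain ⟨h', A'⟩ := A.iterate n
  obtain ⟨hs', ha'⟩ := A.debt_iterate hs ha n
  refine A'.eq_zero (fun j => ?_) i
  rcases le_or_gt j (R + 3 * n) with hj | hj
  · exact debt_eq_zero.2 ⟨hs' j, ha' j hj⟩
  · rw [A'.confined.eq_zero_of_lt A'.balanced (by omega)]
    rfl

lemma iterate_eq_zero (A : Calm a b r u h) (hab : a ≤ b) {n : ℕ}
    (hn : 7 * (r - a) + 2 * (b - a) + 11 ≤ 2 * n) (i : ℤ) :
    (iteration 3 3)^[n] u i = Site.zero := by
  have hr := A.confined.le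
  obtain ⟨m, hm⟩ := Int.eq_ofNat_of_zero_le (a := 2 * (r + 1 - a) + (b + 2 - a)) (by omega)
  obtain ⟨k, rfl⟩ := Nat.exists_eq_add_of_le (show m ≤ n by omega)
  obtain ⟨L, W, hL⟩ := A.exists_swept_iterate A.confined.swept m
  obtain ⟨h', A'⟩ := A.iterate m
  have := A.stackSum_le hab
  rw [add_comm, Function.iterate_add_apply]
  refine A'.iterate_eq_zero_of_sta (fun j => ?_) W.anS (by push_cast at hn; omega) i
  by_contra hj
  exact hj (W.sta j (by have := A'.confined.sta_le j (by omega); omega))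

end Calm
end Erasure

section Initial
variable {a b : ℤ} {S : Finset ℤ} {c : ℤ → Bool}

lemma initial_dfc (S : Finset ℤ) (i : ℤ) : (initial S i).dfc = decide (i ∈ S) := rfl

@[simp] lemma initial_fwS (S : Finset ℤ) (i : ℤ) : (initial S i).fwS = false := rfl

@[simp] lemma debt_initial (S : Finset ℤ) (i : ℤ) : debt (initial S i) = 0 := rfl

lemma balanced_initial (S : Finset ℤ) : Balanced (initial S) 0 where
  height _ := rfl
  nonneg _ := le_rfl
  debt_of_bwS _ _ := rfl
  height_of_dfc _ _ := rfl
  fwS_of_dfc _ _ := rfl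
  bwS_of_dfc _ _ := rfl
  anS_of_dfc _ _ := rfl

lemma confined_initial (hS : S ⊆ Finset.Icc a b) : Confined a b b (initial S) 0 where
  left i hi := by
    have : i ∉ S := fun hiS => by
      have := Finset.mem_Icc.1 (hS hiS)
      omega
    simp [initial, this, Site.zero]
  height_left _ _ := rfl
  height_right _ _ := rfl
  dfc_le i hd := (Finset.mem_Icc.1 (hS (by simpa [initial_dfc] using hd))).2
  sta_le i hs := by simp [initial, Site.zero] at hs
  bwS_le i hb := by simp [initial, Site.zero] at hb
  fwS_le i hf := by simp at hf
  le := le_rfl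

/-- The parity of the number of elements of `S` in `(-∞, i]`. -/
def initialParity (S : Finset ℤ) (i : ℤ) : Bool := decide (Odd (S.filter (· ≤ i)).card)

lemma card_filter_le_eq (S : Finset ℤ) (i : ℤ) :
    (S.filter (· ≤ i)).card = (S.filter (· ≤ i - 1)).card + (decide (i ∈ S)).toNat := by
  have : S.filter (· ≤ i) = S.filter (· ≤ i - 1) ∪ S.filter (· = i) := by
    rw [← Finset.filter_or]
    exact Finset.filter_congr fun j _ => by omega
  rw [this, Finset.card_union_of_disjoint, Finset.filter_eq']
  · split_ifs with h <;> simp [h]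
  · exact Finset.disjoint_filter.2 fun j _ hj => by omega

lemma parity_initial (hS : S ⊆ Finset.Icc a b) (hev : Even S.card) :
    Parity a b (initial S) (initialParity S) where
  step i := by
    simp only [initialParity, card_filter_le_eq S i, initial_dfc]
    generalize (S.filter (· ≤ i - 1)).card = n
    by_cases hi : i ∈ S <;> by_cases hn : Odd n <;>
      simp [hi, hn, Nat.odd_add_one]
  left i hi := by
    have : S.filter (· ≤ i) = ∅ := Finset.filter_false_of_mem fun j hj => by
      have := Finset.mem_Icc.1 (hS hj)
      omega
    simp [initialParity, this]
  right i hi := by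
    have : S.filter (· ≤ i) = S := Finset.filter_true_of_mem fun j hj => by
      have := Finset.mem_Icc.1 (hS hj)
      omega
    simp [initialParity, this, hev]

lemma behind_initial (P : Parity a b (initial S) c) (ha : a ∈ S) :
    Behind (initial S) c a := by
  have hdfc : ∀ i ≤ a, c i = true → (initial S i).dfc = true := fun i hi hc => by
    rcases hi.lt_or_eq with hi | rfl
    · simp [P.left i hi] at hc
    · simpa [initial_dfc] using ha
  have heven : ∀ i < a, (initial S i).dfc = false := fun i hi => by
    have := P.step i
    rw [P.left i hi, P.left (i - 1) (by omega)] at this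
    simpa using this.symm
  refine ⟨fun i hi hc hd => ?_, fun i hi hc hd => ?_, fun i _ _ => rfl, fun i hi hd _ => ?_⟩
  · simp [hdfc i hi hc] at hd
  · simp [hdfc i hi.le hc] at hd
  · simp [heven i hi] at hd

lemma front_initial (P : Parity a b (initial S) c) (ha : a ∈ S) :
    Front 0 b (initial S) c a (5 * (b - a)) where
  behind := behind_initial P ha
  even _ := le_rfl
  odd hc := by
    obtain ⟨y, N⟩ := P.exists_next hc
    have := N.lt
    refine ⟨y, N, ?_⟩
    simp only [potential, blocks, load, initial_fwS, debt_initial, Bool.false_eq_true,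
      Finset.filter_false, Finset.image_empty, Finset.card_empty, Finset.sum_const_zero, ite_self]
    push_cast
    omega

lemma exists_stage_evolution (hS : S ⊆ Finset.Icc a b) (ha : a ∈ S) (hev : Even S.card)
    (t : ℕ) : ∃ h c q, Stage a b t (5 * (b - a) - t) (evolution S t) h c q := by
  have hab := (Finset.mem_Icc.1 (hS ha)).2
  have P := parity_initial hS hev
  have A : Stage a b 0 (5 * (b - a)) (initial S) 0 (initialParity S) a :=
    ⟨balanced_initial S, by simpa using confined_initial hS, P, front_initial P ha,
      fun hT => by have := oddCount_le hab (initialParity S); omega⟩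
  simpa [evolution] using A.iterate hab t

lemma evolution_confined (hS : S ⊆ Finset.Icc a b) (ha : a ∈ S) (hev : Even S.card) (t : ℕ) :
    ∃ h, Balanced (evolution S t) h ∧ Confined a b (b + t) (evolution S t) h := by
  obtain ⟨h, _, _, A⟩ := exists_stage_evolution hS ha hev t
  exact ⟨h, A.balanced, A.confined⟩

lemma evolution_eq_zero (hS : S ⊆ Finset.Icc a b) (ha : a ∈ S) (hev : Even S.card) {t : ℕ}
    (ht : 63 * (b - a) + 11 ≤ 2 * t) (i : ℤ) : evolution S t i = Site.zero := by
  have hab := (Finset.mem_Icc.1 (hS ha)).2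
  obtain ⟨n, hn⟩ := Int.eq_ofNat_of_zero_le (a := 6 * (b - a)) (by omega)
  obtain ⟨k, rfl⟩ := Nat.exists_eq_add_of_le (show n ≤ t by omega)
  obtain ⟨_, _, _, A⟩ := exists_stage_evolution hS ha hev n
  rw [evolution, add_comm, Function.iterate_add_apply]
  exact Calm.iterate_eq_zero ⟨A.balanced, A.confined, A.not_dfc hab (by omega)⟩ hab
    (by push_cast at ht; omega) i

lemma defects_evolution_subset (hS : S ⊆ Finset.Icc a b) (ha : a ∈ S) (hev : Even S.card)
    (t : ℕ) : defects (evolution S t) ⊆ Set.Icc a b := fun i hi => by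
  obtain ⟨h, -, C⟩ := evolution_confined hS ha hev t
  refine ⟨not_lt.1 fun hlt => ?_, C.dfc_le i hi⟩
  simp [defects, C.left i hlt, Site.zero] at hi

lemma supp_evolution_subset (hS : S ⊆ Finset.Icc a b) (ha : a ∈ S) (hev : Even S.card)
    (t : ℕ) : supp (evolution S t) ⊆ Set.Icc a (b + t) := fun i hi => by
  obtain ⟨h, B, C⟩ := evolution_confined hS ha hev t
  exact ⟨not_lt.1 fun hlt => hi (C.left i hlt), not_lt.1 fun hlt => hi (C.eq_zero_of_lt B hlt)⟩

lemma supp_evolution_eq_empty (hS : S ⊆ Finset.Icc a b) (ha : a ∈ S) (hev : Even S.card)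
    {t : ℕ} (ht : 63 * (b - a) + 11 ≤ 2 * t) : supp (evolution S t) = ∅ :=
  Set.eq_empty_of_forall_notMem fun i hi => hi (evolution_eq_zero hS ha hev ht i)

end Initial

end ASR

theorem theorem2 (m : ℕ) (hm : 1 ≤ m) (σ : ℕ → ℤ)
    (hσ : StrictMonoOn σ (Set.Icc 1 (2 * m))) (S : Finset ℤ)
    (hS : S = (Finset.Icc 1 (2 * m)).image σ) (Δ : ℤ) (hΔ : Δ = σ (2 * m) - σ 1) :
    (∀ t : ℕ, ASR.defects (ASR.evolution S t) ⊆ Set.Icc (σ 1) (σ 1 + Δ) ∧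
      ASR.supp (ASR.evolution S t) ⊆ Set.Icc (σ 1) (σ 1 + 78 * Δ)) ∧
    (∀ t : ℕ, 77 * Δ < (t : ℤ) → ASR.supp (ASR.evolution S t) = ∅) := by
  have first_mem : 1 ∈ Set.Icc 1 (2 * m) := ⟨le_rfl, by omega⟩
  have last_mem : 2 * m ∈ Set.Icc 1 (2 * m) := ⟨by omega, le_rfl⟩
  have Δ_pos : 0 < Δ := by have := hσ first_mem last_mem (by omega); omega
  have S_subset : S ⊆ Finset.Icc (σ 1) (σ (2 * m)) := hS ▸ Finset.image_subset_iff.2 fun k hk =>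
    have hk := Finset.mem_Icc.1 hk
    Finset.mem_Icc.2 ⟨hσ.monotoneOn first_mem hk hk.1, hσ.monotoneOn hk last_mem hk.2⟩
  have mem_S : σ 1 ∈ S := hS ▸ Finset.mem_image_of_mem σ (Finset.mem_Icc.2 first_mem)
  have S_even : Even S.card := by
    rw [hS, Finset.card_image_of_injOn (by simpa using hσ.injOn), Nat.card_Icc]
    simp
  have erased (t : ℕ) (ht : 77 * Δ < t) : ASR.supp (ASR.evolution S t) = ∅ :=
    ASR.supp_evolution_eq_empty S_subset mem_S S_even (by omega)
  refine ⟨fun t => ⟨?_, ?_⟩, erased⟩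
  · simpa [hΔ] using ASR.defects_evolution_subset S_subset mem_S S_even t
  · rcases lt_or_ge (77 * Δ) t with ht | ht
    · simp [erased t ht]
    · exact (ASR.supp_evolution_subset S_subset mem_S S_even t).trans
        (Set.Icc_subset_Icc_right (by omega))
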